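/- Setting. Let $a>0$. For integers $l\le r$ consider the open chain of spins $\tfrac12$ on the sites $\Lambda=\{l,\dots,r\}$ (sites $i,j$ have distance $a|i-j|$) with the chaotic Ising Hamiltonian $$H=-\sum_{i=l}^{r-1}\sigma^z_i\sigma^z_{i+1}-\sum_{i=l}^{r}(g\sigma^x_i+h\sigma^z_i),\qquad g=-1.05,\ h=0.5 .$$ Let $L_1,\dots,L_m$ be $2\times2$ matrices (the on-site dissipation; for instance amplitude damping $\tfrac1{\sqrt2}(\sigma^x-i\sigma^y)$, phase damping $\tfrac1{\sqrt2}\sigma^z$, phase depolarizing $\tfrac12\sigma^x,\tfrac12\sigma^y,\tfrac12\sigma^z$), and write $L_{\alpha,k}$ for $L_\alpha$ acting at site $k$. For a rate $\Gamma\ge0$ let $\mathcal V_\Gamma^\dagger(t)=e^{t\mathcal L_\Gamma^\dagger}$ with $$\mathcal L_\Gamma^\dagger O=i[H,O]+\frac{\Gamma}{2}\sum_{k\in\Lambda}\sum_\alpha\bigl(2L_{\alpha,k}^\dagger OL_{\alpha,k}-OL_{\alpha,k}^\dagger L_{\alpha,k}-L_{\alpha,k}^\dagger L_{\alpha,k}O\bigr);$$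 $\Gamma=0$ is the unitary dynamics. Let $A$, $B$ be single-spin operators placed at sites $i$ and $j$, $\|\cdot\|$ the operator norm, and $\|O\|_F=\sqrt{\operatorname{tr}(OO^\dagger)/2^{|\Lambda|}}$. Call $(v,\xi,c)$, all positive, *Lieb–Robinson constants at rate $\Gamma$* if $\|[\mathcal V_\Gamma^\dagger(t)B,A]\|\le c\|A\|\|B\|e^{-(a|i-j|-vt)/\xi}$ for all chains, sites, single-spin operators and $t\ge0$. Let $\|\cdot\|_*$ be $\|\cdot\|$ or $\|\cdot\|_F$. All quantities below are taken in the limit along an increasing sequence of chains: the constant sequence gives any single finite chain, other sequences give the thermodynamic limit. Put $E_\Gamma(t)=\lim\|\mathcal V_\Gamma^\dagger(t)B\|_*$, $Q_\Gamma(i,t)=\lim\|[\mathcal V_\Gamma^\dagger(t)B,A]\|_*$ and $R_\Gamma(i,t)=Q_\Gamma(i,t)/E_\Gamma(t)$. For a signal $q(i,t)$, a front speed $u>0$, a front width $w\ge0$ and a threshold $\delta$, the *width of the light cone revealed by $q$* is the smallest distance $d=a|i-j|\ge w/2$ ($i$ a site) at which the front is not recognized, i.e. $|q(i,\frac{d+w/2}{u})-q(i,\frac{d-w/2}{u})|<\delta$;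 it is $+\infty$ if there is none. **Proposition 1.** (0) For every $a>0$ there are $(v,\xi,c)$ that are Lieb–Robinson constants at every rate $\Gamma\ge0$ for every on-site dissipation. The limits defining $E_\Gamma(t)$ and $Q_\Gamma(i,t)$ exist for all $\Gamma,t\ge0$. Let $\sum_\alpha\|L_\alpha\|^2\le K$ (with $K=2$ for the three examples), let $(v,\xi,c)$ be Lieb–Robinson constants of the unitary chain, and let $\varepsilon>0$ and $0<\Gamma\le\varepsilon av/\xi^2$. There are a constant $C$ depending only on $K,c,a/\xi$, and for each $u>0$ a constant $C'$ depending only on $K,c,a/\xi,v/u$ (so not on the chains, the sites, $A$, $B$, $t$, $\varepsilon$, $\Gamma$), such that: (1) for all sites $i,j$ and all $0\le t\le\sqrt{\varepsilon a/(v\Gamma)}$, $$|E_\Gamma(t)-E_0(t)|\le C\varepsilon\|B\|,\quad |Q_\Gamma(i,t)-Q_0(i,t)|\le C\varepsilon\|A\|\|B\|,\quad |R_\Gamma(i,t)-R_0(i,t)|\le C\varepsilon\|A\|,$$ and $E_\Gamma(t)>0$ if $B\ne0$ and $C\varepsilon\le\frac12$; (2) for every threshold $\delta$ and every front width $0\le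 w\le\sqrt{\varepsilon av/\Gamma}$, the width of the light cone revealed by $Q_\Gamma$ with threshold $\delta$ is at least the minimum of $\sqrt{\varepsilon av/\Gamma}$ and the width of the light cone revealed by the unitary signal $Q_0$ with threshold $\delta+C'\varepsilon\|A\|\|B\|$; the same holds for $R_\Gamma$ and $R_0$ with threshold $\delta+C'\varepsilon\|A\|$. In particular, if the unitary signal reveals the light cone at all distances with this threshold, the dissipative one reveals it up to a width of at least $\sqrt{\varepsilon av/\Gamma}$. -/

import Mathlib

open Filter Topology
open scoped Matrix Matrix.Norms.L2Operator

noncomputable section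

/-- Operators on the Hilbert space of one spin-1/2 at each site of the finite set `Λ ⊆ ℤ`, as
matrices in the product basis.  Throughout, `‖·‖` on matrices is the operator norm induced by the
Euclidean norm. -/
abbrev Op (Λ : Finset ℤ) : Type := Matrix (Λ → Fin 2) (Λ → Fin 2) ℂ

/-- Single-spin operators. -/
abbrev SpinOp : Type := Matrix (Fin 2) (Fin 2) ℂ

/-- Pauli matrix `σˣ`. -/
def pauliX : SpinOp := !![0, 1; 1, 0]

/-- Pauli matrix `σᶻ`. -/
def pauliZ : SpinOp := !![1, 0; 0, -1]

/-- The single-spin operator `X` acting at the site `k ∈ Λ`, and as the identity at every other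
site (by convention `0` if `k ∉ Λ`). -/
def siteOp (Λ : Finset ℤ) (k : ℤ) (X : SpinOp) : Op Λ := fun s s' =>
  if hk : k ∈ Λ then
    if ∀ n : Λ, n.1 ≠ k → s n = s' n then X (s ⟨k, hk⟩) (s' ⟨k, hk⟩) else 0
  else 0

/-- The open Ising chain in transverse and longitudinal fields on the sites `Λ`:
`H = -∑ σᶻᵢ σᶻᵢ₊₁ - ∑ (g σˣᵢ + h σᶻᵢ)`. -/
def isingHamiltonian (g h : ℝ) (Λ : Finset ℤ) : Op Λ :=
  -(∑ i ∈ Λ with i + 1 ∈ Λ, siteOp Λ i pauliZ * siteOp Λ (i + 1) pauliZ)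
    - ∑ i ∈ Λ, ((g : ℂ) • siteOp Λ i pauliX + (h : ℂ) • siteOp Λ i pauliZ)

/-- The chaotic Ising chain: `g = -1.05`, `h = 0.5`. -/
def chaoticIsing (Λ : Finset ℤ) : Op Λ := isingHamiltonian (-1.05) 0.5 Λ

/-- The adjoint Liouvillian of the chaotic Ising chain on `Λ` with the on-site Lindblad operators
`L α` (`α : Fin m`) acting at each site with rate `Γ`:
`𝓛† O = i[H, O] + (Γ/2) ∑ₖ ∑_α (2 L†OL - O L†L - L†L O)`.
Examples of `L`: amplitude damping `(σˣ - iσʸ)/√2`; phase damping `σᶻ/√2`;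
phase depolarizing `σˣ/2, σʸ/2, σᶻ/2`. -/
def adjLiouvillian {m : ℕ} (L : Fin m → SpinOp) (Γ : ℝ) (Λ : Finset ℤ) : Op Λ →ₗ[ℂ] Op Λ where
  toFun O :=
    Complex.I • (chaoticIsing Λ * O - O * chaoticIsing Λ)
      + ((Γ / 2 : ℝ) : ℂ) • ∑ k ∈ Λ, ∑ α,
          ((2 : ℂ) • ((siteOp Λ k (L α))ᴴ * O * siteOp Λ k (L α))
            - O * ((siteOp Λ k (L α))ᴴ * siteOp Λ k (L α))
            - ((siteOp Λ k (L α))ᴴ * siteOp Λ k (L α)) * O)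
  map_add' O O' := by
    rw [add_add_add_comm, ← smul_add, ← smul_add, ← Finset.sum_add_distrib]
    congr 2
    · noncomm_ring
    · refine Finset.sum_congr rfl fun k _ => ?_
      rw [← Finset.sum_add_distrib]
      refine Finset.sum_congr rfl fun α _ => ?_
      simp only [mul_add, add_mul, smul_add]
      abel
  map_smul' z O := by
    simp only [RingHom.id_apply, smul_add, Finset.smul_sum, smul_sub, mul_smul_comm,
      smul_mul_assoc]
    simp only [smul_comm z]

/-- The propagator `exp (t G)` generated by a linear map `G` on a finite-dimensional space. -/
def propagator {E : Type*} [NormedAddCommGroup E] [NormedSpace ℂ E] [FiniteDimensional ℂ E]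
    (G : E →ₗ[ℂ] E) (t : ℝ) : E →L[ℂ] E :=
  NormedSpace.exp ((t : ℂ) • LinearMap.toContinuousLinearMap G)

/-- The adjoint (Heisenberg) evolution `𝓥†(t) = exp (t 𝓛†)`; the unitary one is `Γ = 0`. -/
def heisenberg {m : ℕ} (L : Fin m → SpinOp) (Γ : ℝ) (Λ : Finset ℤ) (t : ℝ) (O : Op Λ) : Op Λ :=
  propagator (adjLiouvillian L Γ Λ) t O

/-- The commutator `[O, A]`. -/
def opCommutator {Λ : Finset ℤ} (O A : Op Λ) : Op Λ := O * A - A * O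

/-- `v, ξ, c` are Lieb-Robinson constants of the chain with lattice spacing `a` and dissipation
rate `Γ`: uniformly in the (open, finite) chain `{l, …, r}`, the sites, the local operators and the
time, `‖[𝓥†(t) B, A]‖ ≤ c ‖B‖ ‖A‖ exp (-(d_AB - v t) / ξ)`. -/
def LiebRobinson {m : ℕ} (L : Fin m → SpinOp) (Γ a v ξ c : ℝ) : Prop :=
  ∀ l r i j : ℤ, i ∈ Finset.Icc l r → j ∈ Finset.Icc l r → ∀ (A B : SpinOp) (t : ℝ), 0 ≤ t →
    ‖opCommutator (heisenberg L Γ (Finset.Icc l r) t (siteOp _ j B)) (siteOp _ i A)‖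
      ≤ c * ‖B‖ * ‖A‖ * Real.exp (-(a * |(i : ℝ) - j| - v * t) / ξ)

/-- The two norms: the operator norm and the normalized Frobenius norm. -/
inductive NormKind
  | operator
  | frobenius

/-- The operator norm `‖O‖`, or the normalized Frobenius norm `√(tr(O O†) / 2 ^ N)`. -/
def NormKind.norm (κ : NormKind) {Λ : Finset ℤ} (O : Op Λ) : ℝ :=
  match κ with
  | .operator => ‖O‖
  | .frobenius => √((O * Oᴴ).trace.re / 2 ^ Λ.card)

/-- The norm of `[𝓥†(t) B, A]` in the chain `{l, …, r}`, with `B` at site `j` and `A` at site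
`i`. -/
def commNorm (κ : NormKind) {m : ℕ} (L : Fin m → SpinOp) (Γ : ℝ) (l r : ℤ)
    (j : ℤ) (B : SpinOp) (i : ℤ) (A : SpinOp) (t : ℝ) : ℝ :=
  κ.norm (opCommutator (heisenberg L Γ (Finset.Icc l r) t (siteOp _ j B)) (siteOp _ i A))

/-- The norm of `𝓥†(t) B` in the chain `{l, …, r}`, with `B` at site `j`. -/
def evolNorm (κ : NormKind) {m : ℕ} (L : Fin m → SpinOp) (Γ : ℝ) (l r : ℤ)
    (j : ℤ) (B : SpinOp) (t : ℝ) : ℝ :=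
  κ.norm (heisenberg L Γ (Finset.Icc l r) t (siteOp _ j B))

/-- The limit of `commNorm` along the chains `{l n, …, r n}`.  For constant `l` and `r` this is the
value in one finite chain. -/
def commSignal (κ : NormKind) {m : ℕ} (L : Fin m → SpinOp) (Γ : ℝ) (l r : ℕ → ℤ)
    (j : ℤ) (B : SpinOp) (i : ℤ) (A : SpinOp) (t : ℝ) : ℝ :=
  limUnder atTop fun n => commNorm κ L Γ (l n) (r n) j B i A t

/-- The limit of `evolNorm` along the chains `{l n, …, r n}`. -/
def evolSignal (κ : NormKind) {m : ℕ} (L : Fin m → SpinOp) (Γ : ℝ) (l r : ℕ → ℤ)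
    (j : ℤ) (B : SpinOp) (t : ℝ) : ℝ :=
  limUnder atTop fun n => evolNorm κ L Γ (l n) (r n) j B t

/-- The corrected signal `‖[𝓥†(t) B, A]‖ / ‖𝓥†(t) B‖`. -/
def ratioSignal (κ : NormKind) {m : ℕ} (L : Fin m → SpinOp) (Γ : ℝ) (l r : ℕ → ℤ)
    (j : ℤ) (B : SpinOp) (i : ℤ) (A : SpinOp) (t : ℝ) : ℝ :=
  commSignal κ L Γ l r j B i A t / evolSignal κ L Γ l r j B t

/-- The width of the light cone revealed by a signal `q i t` (probe at the site `i`, time `t`) of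
a perturbation at site `j`: the smallest distance `d = a |i - j|` at which the front, moving at
speed `u` with front width `w`, is not recognized because the signal changes by less than the
threshold `δ` between the times `(d - w / 2) / u` and `(d + w / 2) / u`.  It is `⊤` if the front is
recognized at all sites of `S`. -/
def lightConeWidth (S : Set ℤ) (j : ℤ) (a u w δ : ℝ) (q : ℤ → ℝ → ℝ) : EReal :=
  sInf {d : EReal | ∃ i ∈ S, d = ((a * |(i : ℝ) - j| : ℝ) : EReal) ∧
    w / 2 ≤ a * |(i : ℝ) - j| ∧
    |q i ((a * |(i : ℝ) - j| + w / 2) / u) - q i ((a * |(i : ℝ) - j| - w / 2) / u)| < δ}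

end

/-! The difference of the dissipative and the unitary evolution of `B` is driven by the dissipators
applied to the unitarily evolved operator x(s). Since the dissipative semigroup contracts the
operator norm, the difference is at most the time integral of Γ/2 times ∑ₖ ‖Dₖ x(s)‖. A dissipator
is built from commutators with operators at its own site (`dissipator_eq`). Hence ‖Dₖ x(s)‖ is of
order K‖B‖ inside the light cone and, by the Lieb-Robinson bound of the unitary chain, exponentially
small outside. About 2vs/a sites lie inside, which gives ΓK‖B‖(2(v/a)t² + const·t), see
`norm_heisenberg_sub_unitary_le`. Up to the time √(εa/(vΓ)) the quadratic term is of order ε, and Γ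
≤ εav/ξ² makes the linear term of order ε too.

Both norms are 1-Lipschitz for the operator norm, so this one estimate serves all signals, in finite
chains and in the limit. For the ratio, unitary evolution does not decrease the norms, so E₀ ≥
‖B‖/√2. Signals that are uniformly close recognize the front at the same sites up to a shift of the
threshold (`min_lightConeWidth_le`).

Lieb-Robinson constants independent of the dissipation come from measuring the influence on a site
by the distance to its commutant. On-site generators contract the norm and preserve every commutant,
so they never increase this distance. Only bonds carry influence, and only to neighbours; Grönwall's
inequality for the sum weighted by e^|i-j| finishes. The resulting decay also controls the bonds
added when a chain grows, which gives the limits.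

Integrals and product formulas are replaced by differential inequalities for right Dini derivatives
of seminorms (`DiniLE`). -/

noncomputable section

/-! ### Dini derivatives of seminorms and comparison along solutions -/

section Dini

variable {E : Type*} [NormedAddCommGroup E] [NormedSpace ℂ E]

/-- The upper right Dini derivative at `s = 0` of `p (x + s • G x)` is at most `q x`. -/
def DiniLE (p : Seminorm ℂ E) (G : E → E) (q : E → ℝ) : Prop :=
  ∀ x : E, ∀ η : ℝ, 0 < η → ∀ᶠ s : ℝ in 𝓝[>] 0, p (x + (s : ℂ) • G x) ≤ p x + s * (q x + η)

lemma DiniLE.mono {p : Seminorm ℂ E} {G : E → E} {q q' : E → ℝ} (h : DiniLE p G q)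
    (hq : ∀ x, q x ≤ q' x) : DiniLE p G q' := by
  intro x η hη
  filter_upwards [h x η hη, self_mem_nhdsWithin] with s hs (hs0 : 0 < s)
  refine hs.trans ?_
  have := hq x
  gcongr

lemma DiniLE.zero (p : Seminorm ℂ E) : DiniLE p (fun _ => 0) (fun _ => 0) := by
  intro x η hη
  filter_upwards [self_mem_nhdsWithin] with s (hs0 : 0 < s)
  simp only [smul_zero, add_zero, zero_add, le_add_iff_nonneg_right]
  positivity

lemma tendsto_mul_nhdsGT_zero {r : ℝ} (hr : 0 < r) :
    Tendsto (fun s : ℝ => r * s) (𝓝[>] 0) (𝓝[>] 0) := by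
  refine tendsto_nhdsWithin_of_tendsto_nhds_of_eventually_within _ ?_ ?_
  · have : Tendsto (fun s : ℝ => r * s) (𝓝 0) (𝓝 (r * 0)) := tendsto_id.const_mul r
    rw [mul_zero] at this
    exact this.mono_left nhdsWithin_le_nhds
  · filter_upwards [self_mem_nhdsWithin] with s (hs0 : 0 < s)
    exact mul_pos hr hs0

/-- A step s along the sum is the midpoint of steps 2s along the summands, so convexity of p
suffices. This is the substitute for a Trotter formula. -/
lemma DiniLE.add {p : Seminorm ℂ E} {G₁ G₂ : E → E} {q₁ q₂ : E → ℝ} (h₁ : DiniLE p G₁ q₁)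
    (h₂ : DiniLE p G₂ q₂) : DiniLE p (fun x => G₁ x + G₂ x) (fun x => q₁ x + q₂ x) := by
  intro x η hη
  have ht := tendsto_mul_nhdsGT_zero (zero_lt_two (α := ℝ))
  filter_upwards [ht.eventually (h₁ x (η / 2) (by positivity)),
    ht.eventually (h₂ x (η / 2) (by positivity))] with s hs₁ hs₂
  have e : x + (s : ℂ) • (G₁ x + G₂ x) = (1 / 2 : ℂ) • (x + ((2 * s : ℝ) : ℂ) • G₁ x)
      + (1 / 2 : ℂ) • (x + ((2 * s : ℝ) : ℂ) • G₂ x) := by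
    push_cast
    module
  rw [e]
  refine (map_add_le_add p _ _).trans ?_
  rw [map_smul_eq_mul, map_smul_eq_mul]
  have : ‖(1 / 2 : ℂ)‖ = 1 / 2 := by norm_num
  rw [this]
  linarith

lemma DiniLE.sum {ι : Type*} {p : Seminorm ℂ E} {G : ι → E → E} {q : ι → E → ℝ} (S : Finset ι)
    (h : ∀ i ∈ S, DiniLE p (G i) (q i)) :
    DiniLE p (fun x => ∑ i ∈ S, G i x) (fun x => ∑ i ∈ S, q i x) := by
  classical
  induction S using Finset.induction_on with
  | empty => simpa using DiniLE.zero p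
  | insert a S ha ih =>
    simp only [Finset.sum_insert ha]
    exact (h a (Finset.mem_insert_self _ _)).add
      (ih fun i hi => h i (Finset.mem_insert_of_mem hi))

lemma DiniLE.smul {p : Seminorm ℂ E} {G : E → E} {r : ℝ} (hr : 0 ≤ r)
    (h : DiniLE p G fun _ => 0) : DiniLE p (fun x => (r : ℂ) • G x) (fun _ => 0) := by
  rcases hr.eq_or_lt with rfl | hr
  · simpa using DiniLE.zero p
  intro x η hη
  filter_upwards [(tendsto_mul_nhdsGT_zero hr).eventually (h x (η / r) (by positivity))] with s hs
  have e : (s : ℂ) • (r : ℂ) • G x = ((r * s : ℝ) : ℂ) • G x := by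
    rw [smul_smul, Complex.ofReal_mul, mul_comm]
  rw [e]
  refine hs.trans (le_of_eq ?_)
  field_simp
  ring

/-- A bounded perturbation. -/
lemma DiniLE.of_le {p : Seminorm ℂ E} {G : E → E} {q : E → ℝ} (h : ∀ x, p (G x) ≤ q x) :
    DiniLE p G q := by
  intro x η hη
  filter_upwards [self_mem_nhdsWithin] with s (hs0 : 0 < s)
  refine (map_add_le_add p _ _).trans ?_
  rw [map_smul_eq_mul, Complex.norm_real, Real.norm_of_nonneg hs0.le]
  have := h x
  gcongr
  linarith

lemma DiniLE.seminorm_sum {ι : Type*} (S : Finset ι) {p : ι → Seminorm ℂ E} {G : E → E}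
    {q : ι → E → ℝ} (h : ∀ i ∈ S, DiniLE (p i) G (q i)) :
    DiniLE (∑ i ∈ S, p i) G (fun x => ∑ i ∈ S, q i x) := by
  classical
  induction S using Finset.induction_on with
  | empty =>
    intro x η hη
    filter_upwards [self_mem_nhdsWithin] with s (hs0 : 0 < s)
    simp only [Finset.sum_empty, zero_apply]
    positivity
  | insert a S ha ih =>
    intro x η hη
    filter_upwards [h a (Finset.mem_insert_self _ _) x (η / 2) (by positivity),
      ih (fun i hi => h i (Finset.mem_insert_of_mem hi)) x (η / 2) (by positivity)] with s h1 h2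
    simp only [Finset.sum_insert ha, add_apply]
    linarith

lemma DiniLE.seminorm_smul {p : Seminorm ℂ E} {G : E → E} {q : E → ℝ} (w : NNReal)
    (h : DiniLE p G q) : DiniLE (w • p) G (fun x => w * q x) := by
  intro x η hη
  have hw : 0 < (w : ℝ) + 1 := by positivity
  filter_upwards [h x (η / (w + 1)) (by positivity), self_mem_nhdsWithin] with s h1 (hs0 : 0 < s)
  simp only [smul_apply, NNReal.smul_def, smul_eq_mul]
  have h2 : (w : ℝ) * (η / (w + 1)) ≤ η := by
    rw [mul_div_assoc', div_le_iff₀ hw]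
    nlinarith
  calc (w : ℝ) * p (x + (s : ℂ) • G x) ≤ w * (p x + s * (q x + η / (w + 1))) := by gcongr
    _ = w * p x + s * (w * q x + w * (η / (w + 1))) := by ring
    _ ≤ _ := by gcongr

/-- Upper bound for the right derivative of `p ∘ y` along a solution of `y' = G y + g`. -/
lemma DiniLE.frequently_slope_lt {p : Seminorm ℂ E} {G : E → E} {q : E → ℝ} (h : DiniLE p G q)
    {M : ℝ} (hM : ∀ x, p x ≤ M * ‖x‖) {y : ℝ → E} {g : E} {t : ℝ}
    (hy : HasDerivAt y (G (y t) + g) t) {r : ℝ} (hr : q (y t) + p g < r) :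
    ∃ᶠ z in 𝓝[>] t, slope (fun s => p (y s)) t z < r := by
  refine Eventually.frequently ?_
  -- One η pays for the Dini bound, one for the remainder of the derivative, and the third keeps the
  -- inequality strict.
  obtain ⟨η, hη, hηr⟩ : ∃ η > 0, q (y t) + p g + 3 * η = r :=
    ⟨(r - (q (y t) + p g)) / 3, by linarith, by ring⟩
  have hM' : ∀ x, p x ≤ (|M| + 1) * ‖x‖ := fun x => (hM x).trans <| by
    have := le_abs_self M
    gcongr
    linarith
  have ho := (hasDerivAt_iff_isLittleO.1 hy).def (c := η / (|M| + 1)) (by positivity)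
  have hsh : Tendsto (fun z : ℝ => z - t) (𝓝[>] t) (𝓝[>] 0) := by
    refine tendsto_nhdsWithin_of_tendsto_nhds_of_eventually_within _ ?_ ?_
    · have : Tendsto (fun z : ℝ => z - t) (𝓝 t) (𝓝 (t - t)) := tendsto_id.sub_const t
      rw [sub_self] at this
      exact this.mono_left nhdsWithin_le_nhds
    · filter_upwards [self_mem_nhdsWithin] with s (hs0 : t < s)
      exact sub_pos.2 hs0
  filter_upwards [hsh.eventually (h (y t) η hη), ho.filter_mono nhdsWithin_le_nhds,
    self_mem_nhdsWithin] with z h1 h2 (hz : t < z)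
  have hz' : 0 < z - t := sub_pos.2 hz
  rw [slope_def_field, div_lt_iff₀ hz']
  set s := z - t
  have e : y z = (y t + (s : ℂ) • G (y t)) + (s : ℂ) • g
      + (y z - y t - s • (G (y t) + g)) := by
    rw [← Complex.coe_smul, smul_add]
    abel
  have h3 : p (y z) ≤ p (y t + (s : ℂ) • G (y t)) + s * p g
      + p (y z - y t - s • (G (y t) + g)) := by
    conv_lhs => rw [e]
    refine (map_add_le_add p _ _).trans ?_
    gcongr
    refine (map_add_le_add p _ _).trans ?_
    rw [map_smul_eq_mul, Complex.norm_real, Real.norm_of_nonneg hz'.le]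
  have h4 : p (y z - y t - s • (G (y t) + g)) ≤ η * s := by
    refine (hM' _).trans ?_
    rw [Real.norm_of_nonneg hz'.le] at h2
    calc _ ≤ (|M| + 1) * (η / (|M| + 1) * s) := by gcongr
      _ = η * s := by field_simp
  rw [← hηr]
  nlinarith

lemma Seminorm.continuousOn_comp_of_le {p : Seminorm ℂ E} {M : ℝ} (hM : ∀ x, p x ≤ M * ‖x‖)
    {y : ℝ → E} {S : Set ℝ} (hy : ContinuousOn y S) : ContinuousOn (fun s => p (y s)) S := by
  have hp : Continuous p := by
    refine LipschitzWith.continuous (K := M.toNNReal) (LipschitzWith.of_dist_le_mul fun x y => ?_)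
    rw [Real.dist_eq, dist_eq_norm]
    refine (abs_sub_map_le_sub p x y).trans ((hM _).trans ?_)
    gcongr
    exact Real.le_coe_toNNReal M
  exact hp.comp_continuousOn hy

/-- Duhamel's estimate without integrals: right slopes bounded by those of the majorant Φ prevent p
∘ y from overtaking it. With q = 0 only the forcing g contributes. -/
lemma DiniLE.le_of_hasDerivAt {p : Seminorm ℂ E} {G : E → E} {q : E → ℝ} (h : DiniLE p G q)
    {M : ℝ} (hM : ∀ x, p x ≤ M * ‖x‖) {y g : ℝ → E} {Φ Φ' : ℝ → ℝ} {T : ℝ} (hT : 0 ≤ T)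
    (hy : ∀ t, HasDerivAt y (G (y t) + g t) t) (h0 : p (y 0) ≤ Φ 0)
    (hΦ : ∀ t, HasDerivAt Φ (Φ' t) t)
    (hb : ∀ t, 0 ≤ t → t < T → q (y t) + p (g t) ≤ Φ' t) : p (y T) ≤ Φ T := by
  refine image_le_of_liminf_slope_right_le_deriv_boundary (f := fun s => p (y s)) (a := 0) (b := T)
    (Seminorm.continuousOn_comp_of_le hM fun t _ => (hy t).continuousAt.continuousWithinAt) h0
    (B := Φ) (B' := Φ')
    (fun t _ => (hΦ t).continuousAt.continuousWithinAt)
    (fun t _ => (hΦ t).hasDerivWithinAt) ?_ (Set.right_mem_Icc.2 hT)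
  intro t ht r hr
  exact h.frequently_slope_lt hM (hy t) ((hb t ht.1 ht.2).trans_lt hr)

lemma DiniLE.le_exp_of_hasDerivAt {p : Seminorm ℂ E} {G : E → E} {κ : ℝ}
    (h : DiniLE p G fun x => κ * p x) {M : ℝ} (hM : ∀ x, p x ≤ M * ‖x‖) {y : ℝ → E}
    {T : ℝ} (hT : 0 ≤ T) (hy : ∀ t, HasDerivAt y (G (y t)) t) :
    p (y T) ≤ p (y 0) * Real.exp (κ * T) := by
  have := le_gronwallBound_of_liminf_deriv_right_le (f := fun s => p (y s))
    (f' := fun s => κ * p (y s)) (δ := p (y 0)) (K := κ) (ε := 0) (a := 0) (b := T)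
    (Seminorm.continuousOn_comp_of_le hM fun t _ => (hy t).continuousAt.continuousWithinAt)
    (fun t _ r hr => by
      have := h.frequently_slope_lt hM (y := y) (g := 0) (t := t) (by simpa using hy t) (r := r)
        (by simpa using hr)
      simpa [slope_def_field, div_eq_inv_mul] using this) le_rfl (fun t _ => by simp) T
    (Set.right_mem_Icc.2 hT)
  simpa [gronwallBound_ε0] using this

end Dini

/-! ### The propagator solves the evolution equation -/

section Propagator

variable {E : Type*} [NormedAddCommGroup E] [NormedSpace ℂ E] [FiniteDimensional ℂ E]

lemma hasDerivAt_propagator (G : E →ₗ[ℂ] E) (x : E) (t : ℝ) :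
    HasDerivAt (fun s => propagator G s x) (G (propagator G t x)) t := by
  have : CompleteSpace E := FiniteDimensional.complete ℂ E
  have h1 := HasDerivAt.scomp (h := fun s : ℝ => (s : ℂ)) t
    (hasDerivAt_exp_smul_const' (𝕂 := ℂ) (LinearMap.toContinuousLinearMap G) (t : ℂ))
    Complex.ofRealCLM.hasDerivAt
  rw [Complex.ofRealCLM_apply, Complex.ofReal_one, one_smul] at h1
  exact ((ContinuousLinearMap.apply ℂ E x).restrictScalars ℝ).hasFDerivAt.comp_hasDerivAt t h1

@[simp] lemma propagator_zero (G : E →ₗ[ℂ] E) (x : E) : propagator G 0 x = x := by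
  simp [propagator]

end Propagator

/-! ### Tensoring with the identity -/

section Amplification

open scoped Kronecker

variable {α β γ : Type*} [Fintype α] [DecidableEq α] [Fintype β] [DecidableEq β]
  [Fintype γ] [DecidableEq γ]

/-- The amplification `M ↦ M ⊗ 1` along a splitting `γ ≃ α × β` of the index set. -/
def ampl (e : γ ≃ α × β) : Matrix α α ℂ →⋆ₐ[ℂ] Matrix γ γ ℂ where
  toFun M := (M ⊗ₖ (1 : Matrix β β ℂ)).submatrix e e
  map_one' := by simp
  map_mul' M N := by
    rw [Matrix.submatrix_mul_equiv, ← Matrix.mul_kronecker_mul, one_mul]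
  map_zero' := by simp
  map_add' M N := by rw [Matrix.add_kronecker]; rfl
  commutes' r := by
    ext x y
    simp only [Matrix.submatrix_apply, Matrix.kroneckerMap_apply, Matrix.algebraMap_matrix_apply,
      Matrix.one_apply]
    by_cases h1 : (e x).1 = (e y).1 <;> by_cases h2 : (e x).2 = (e y).2
    · have : x = y := e.injective (Prod.ext h1 h2)
      simp [this]
    · have : x ≠ y := fun h => h2 (by rw [h])
      simp [h1, h2, this]
    · have : x ≠ y := fun h => h1 (by rw [h])
      simp [h1, h2, this]
    · have : x ≠ y := fun h => h1 (by rw [h])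
      simp [h1, h2, this]
  map_star' M := by
    simp only [Matrix.star_eq_conjTranspose, Matrix.conjTranspose_submatrix,
      Matrix.conjTranspose_kronecker, Matrix.conjTranspose_one]

lemma ampl_apply (e : γ ≃ α × β) (M : Matrix α α ℂ) (x y : γ) :
    ampl e M x y = if (e x).2 = (e y).2 then M (e x).1 (e y).1 else 0 := by
  simp [ampl, Matrix.one_apply]

lemma ampl_injective [Nonempty β] (e : γ ≃ α × β) : Function.Injective (ampl e) := by
  intro M N h
  obtain ⟨b⟩ := ‹Nonempty β›
  ext i j
  have := congrFun (congrFun h (e.symm (i, b))) (e.symm (j, b))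
  simpa [ampl_apply] using this

/-- Injective star homomorphisms of C*-algebras are isometric. -/
lemma norm_ampl [Nonempty β] (e : γ ≃ α × β) (M : Matrix α α ℂ) : ‖ampl e M‖ = ‖M‖ :=
  NonUnitalStarAlgHom.norm_map (ampl e) (ampl_injective e) M

lemma trace_ampl (e : γ ≃ α × β) (M : Matrix α α ℂ) :
    (ampl e M).trace = Fintype.card β * M.trace := by
  rw [Matrix.trace, ← e.symm.sum_comp]
  simp [ampl_apply, Fintype.sum_prod_type, Matrix.trace, Finset.mul_sum]

end Amplification

/-! ### Lindblad generators contract the operator norm -/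

section Generators

variable {n : Type*} [Fintype n]

/-- The Hamiltonian part `i [h, O]` of a generator. -/
def hamGen (h O : Matrix n n ℂ) : Matrix n n ℂ := Complex.I • (h * O - O * h)

/-- The dissipative part `2 Lᴴ O L - O Lᴴ L - Lᴴ L O` of a generator. -/
def dissipator (L O : Matrix n n ℂ) : Matrix n n ℂ :=
  (2 : ℂ) • (Lᴴ * O * L) - O * (Lᴴ * L) - (Lᴴ * L) * O

lemma hamGen_add (h h' O : Matrix n n ℂ) : hamGen (h + h') O = hamGen h O + hamGen h' O := by
  simp only [hamGen, add_mul, mul_add]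
  module

lemma hamGen_sum {ι : Type*} (S : Finset ι) (h : ι → Matrix n n ℂ) (O : Matrix n n ℂ) :
    hamGen (∑ i ∈ S, h i) O = ∑ i ∈ S, hamGen (h i) O := by
  simp only [hamGen, Finset.sum_mul, Finset.mul_sum, ← Finset.sum_sub_distrib, Finset.smul_sum]

lemma hamGen_eq_zero {h O : Matrix n n ℂ} (hc : Commute h O) : hamGen h O = 0 := by
  rw [hamGen, hc.eq, sub_self, smul_zero]

/-- The commutator form exposes locality: the dissipator vanishes on operators commuting with L and
Lᴴ, and is small on those that nearly do. -/
lemma dissipator_eq (L O : Matrix n n ℂ) :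
    dissipator L O = Lᴴ * (O * L - L * O) + (Lᴴ * O - O * Lᴴ) * L := by
  rw [dissipator, two_smul]
  noncomm_ring

lemma dissipator_eq_zero {L O : Matrix n n ℂ} (h : Commute L O) (h' : Commute Lᴴ O) :
    dissipator L O = 0 := by
  rw [dissipator_eq, h.eq, h'.eq]
  simp

variable [DecidableEq n]

/-- Stinespring: stacking V and W into one column R turns the map into O ↦ Rᴴ(O ⊗ 1)R, and ‖R‖² =
‖RᴴR‖. -/
lemma norm_kraus_le (V W O : Matrix n n ℂ) :
    ‖Vᴴ * O * V + Wᴴ * O * W‖ ≤ ‖Vᴴ * V + Wᴴ * W‖ * ‖O‖ := by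
  obtain ⟨R, hR⟩ : ∃ R : Matrix (n × Fin 2) n ℂ, ∀ i a j, R (i, a) j = ![V, W] a i j :=
    ⟨fun i j => ![V, W] i.2 i.1 j, fun _ _ _ => rfl⟩
  have key : ∀ X : Matrix n n ℂ, Rᴴ * ampl (Equiv.refl (n × Fin 2)) X * R
      = Vᴴ * X * V + Wᴴ * X * W := by
    intro X
    ext i j
    simp [Matrix.mul_apply, Fintype.sum_prod_type, ampl_apply, hR, Finset.sum_add_distrib]
  have h1 : Rᴴ * R = Vᴴ * V + Wᴴ * W := by
    have := key 1
    rwa [map_one, Matrix.mul_one, Matrix.mul_one, Matrix.mul_one] at this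
  rw [← key, ← h1, Matrix.l2_opNorm_conjTranspose_mul_self]
  calc _ ≤ ‖Rᴴ‖ * ‖ampl (Equiv.refl (n × Fin 2)) O‖ * ‖R‖ :=
        (Matrix.l2_opNorm_mul _ _).trans (by gcongr; exact Matrix.l2_opNorm_mul _ _)
    _ = _ := by rw [norm_ampl, Matrix.l2_opNorm_conjTranspose]; ring

/-- A Lindblad generator in the form `O ↦ Kᴴ O + O K + Lᴴ O L` that vanishes at `1` generates a
contraction semigroup of the operator norm. -/
lemma diniLE_norm_lindblad [Nonempty n] {K L : Matrix n n ℂ} (hKL : Kᴴ + K + Lᴴ * L = 0) :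
    DiniLE (normSeminorm ℂ (Matrix n n ℂ)) (fun O => Kᴴ * O + O * K + Lᴴ * O * L)
      (fun _ => 0) := by
  intro O η hη
  set C : ℝ := 2 * ‖K‖ ^ 2 * ‖O‖
  have hC : 0 ≤ C := by positivity
  have : Set.Ioo (0 : ℝ) (η / (C + 1)) ∈ 𝓝[>] (0 : ℝ) := Ioo_mem_nhdsGT (by positivity)
  filter_upwards [this] with s ⟨hs0, hs1⟩
  simp only [coe_normSeminorm, zero_add]
  rw [lt_div_iff₀ (by positivity)] at hs1
  have hsq : ((√s : ℝ) : ℂ) * ((√s : ℝ) : ℂ) = (s : ℂ) := by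
    rw [← Complex.ofReal_mul, Real.mul_self_sqrt hs0.le]
  -- Up to s² KᴴXK, the Euler step is the Kraus map with operators 1 + sK and √s L. By `hKL` this
  -- map is unital up to order s², hence nearly contractive; `C` collects the two second-order
  -- errors.
  have e1 : ∀ X : Matrix n n ℂ,
      (1 + (s : ℂ) • K)ᴴ * X * (1 + (s : ℂ) • K) + (((√s : ℝ) : ℂ) • L)ᴴ * X * (((√s : ℝ) : ℂ) • L)
        = X + (s : ℂ) • (Kᴴ * X + X * K + Lᴴ * X * L) + (s * s : ℂ) • (Kᴴ * X * K) := by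
    intro X
    have : (star (s : ℂ)) = s := by simp
    have h2 : (star ((√s : ℝ) : ℂ)) = ((√s : ℝ) : ℂ) := by simp
    simp only [Matrix.conjTranspose_add, Matrix.conjTranspose_one, Matrix.conjTranspose_smul,
      this, h2, smul_mul_assoc, mul_smul_comm, add_mul, mul_add, one_mul, mul_one, smul_smul, hsq,
      smul_add]
    abel
  have e2 := e1 1
  rw [mul_one, mul_one, mul_one, mul_one, one_mul, hKL, smul_zero, add_zero] at e2
  have hk := norm_kraus_le (1 + (s : ℂ) • K) (((√s : ℝ) : ℂ) • L) O
  rw [e2, e1] at hk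
  have hns : ‖(s * s : ℂ)‖ = s * s := by
    rw [norm_mul, Complex.norm_real, Real.norm_of_nonneg hs0.le]
  have hKn : ‖Kᴴ‖ = ‖K‖ := Matrix.l2_opNorm_conjTranspose K
  have h1 : ‖(1 : Matrix n n ℂ) + (s * s : ℂ) • (Kᴴ * K)‖ ≤ 1 + s * s * ‖K‖ ^ 2 := by
    refine (norm_add_le _ _).trans ?_
    rw [norm_smul, hns, CStarRing.norm_one]
    gcongr
    exact (norm_mul_le _ _).trans (by rw [hKn, sq])
  have h2 : ‖(s * s : ℂ) • (Kᴴ * O * K)‖ ≤ s * s * (‖K‖ ^ 2 * ‖O‖) := by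
    rw [norm_smul, hns]
    gcongr
    calc _ ≤ ‖Kᴴ‖ * ‖O‖ * ‖K‖ := norm_mul₃_le
      _ = _ := by rw [hKn]; ring
  have h3 := norm_sub_le (O + (s : ℂ) • (Kᴴ * O + O * K + Lᴴ * O * L)
    + (s * s : ℂ) • (Kᴴ * O * K)) ((s * s : ℂ) • (Kᴴ * O * K))
  rw [add_sub_cancel_right] at h3
  calc _ ≤ (1 + s * s * ‖K‖ ^ 2) * ‖O‖ + s * s * (‖K‖ ^ 2 * ‖O‖) := by
        refine h3.trans (add_le_add (hk.trans ?_) h2)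
        gcongr
    _ = ‖O‖ + s * (s * C) := by ring
    _ ≤ ‖O‖ + s * η := by
        gcongr
        nlinarith

lemma diniLE_norm_hamGen [Nonempty n] {h : Matrix n n ℂ} (hh : hᴴ = h) :
    DiniLE (normSeminorm ℂ (Matrix n n ℂ)) (hamGen h) (fun _ => 0) := by
  have := diniLE_norm_lindblad (K := -(Complex.I • h)) (L := 0) (by simp [hh])
  convert this using 2 with O
  simp [hamGen, hh, sub_eq_add_neg]

lemma diniLE_norm_dissipator [Nonempty n] (L : Matrix n n ℂ) :
    DiniLE (normSeminorm ℂ (Matrix n n ℂ)) (dissipator L) (fun _ => 0) := by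
  have h2 : ((√2 : ℝ) : ℂ) * ((√2 : ℝ) : ℂ) = 2 := by
    rw [← Complex.ofReal_mul, Real.mul_self_sqrt (by norm_num)]; norm_num
  -- The factor √2 accounts for the coefficient 2 of the jump term.
  have := diniLE_norm_lindblad (K := -(Lᴴ * L)) (L := ((√2 : ℝ) : ℂ) • L) (by
    simp only [Matrix.conjTranspose_neg, Matrix.conjTranspose_mul, Matrix.conjTranspose_conjTranspose,
      Matrix.conjTranspose_smul, smul_mul_assoc, mul_smul_comm, smul_smul]
    simp only [RCLike.star_def, Complex.conj_ofReal, h2]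
    module)
  convert this using 2 with O
  simp only [dissipator, Matrix.conjTranspose_neg, Matrix.conjTranspose_mul,
    Matrix.conjTranspose_conjTranspose, Matrix.conjTranspose_smul, smul_mul_assoc, mul_smul_comm,
    smul_smul, RCLike.star_def, Complex.conj_ofReal, h2, neg_mul, mul_neg]
  abel

end Generators

/-! ### Operators at a site and embeddings of chains -/

section SiteOperators

variable {Λ Λ' : Finset ℤ} {k k' : ℤ}

lemma siteOp_of_mem (hk : k ∈ Λ) (X : SpinOp) :
    siteOp Λ k X = ampl (Equiv.funSplitAt (⟨k, hk⟩ : Λ) (Fin 2)) X := by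
  ext s s'
  rw [ampl_apply]
  simp only [siteOp, hk, dite_true, Equiv.funSplitAt_apply]
  congr 1
  simp only [funext_iff, Subtype.forall, eq_iff_iff]
  exact ⟨fun h n hn hnk => h n hn fun e => hnk (Subtype.ext e),
    fun h n hn hnk => h n hn fun e => hnk (congrArg Subtype.val e)⟩

lemma siteOp_of_notMem (hk : k ∉ Λ) (X : SpinOp) : siteOp Λ k X = 0 := by
  ext s s'
  simp [siteOp, hk]

lemma siteOp_mul (X Y : SpinOp) : siteOp Λ k X * siteOp Λ k Y = siteOp Λ k (X * Y) := by
  by_cases hk : k ∈ Λ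
  · simp only [siteOp_of_mem hk, map_mul]
  · simp only [siteOp_of_notMem hk, mul_zero]

lemma siteOp_conjTranspose (X : SpinOp) : (siteOp Λ k X)ᴴ = siteOp Λ k Xᴴ := by
  by_cases hk : k ∈ Λ
  · simp only [siteOp_of_mem hk]
    exact (map_star (ampl _) X).symm
  · simp only [siteOp_of_notMem hk, Matrix.conjTranspose_zero]

lemma siteOp_zero : siteOp Λ k 0 = 0 := by
  by_cases hk : k ∈ Λ
  · simp only [siteOp_of_mem hk, map_zero]
  · exact siteOp_of_notMem hk _

lemma norm_siteOp (hk : k ∈ Λ) (X : SpinOp) : ‖siteOp Λ k X‖ = ‖X‖ := by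
  rw [siteOp_of_mem hk, norm_ampl]

lemma norm_siteOp_le (X : SpinOp) : ‖siteOp Λ k X‖ ≤ ‖X‖ := by
  by_cases hk : k ∈ Λ
  · exact (norm_siteOp hk X).le
  · simp [siteOp_of_notMem hk]

/-- A matrix that is diagonal in the spin at `k`, with entries independent of that spin, commutes
with the operators at the site `k`. -/
lemma commute_siteOp_of_forall (hk : k ∈ Λ) {M : Op Λ}
    (h0 : ∀ s s' : Λ → Fin 2, s ⟨k, hk⟩ ≠ s' ⟨k, hk⟩ → M s s' = 0)
    (h1 : ∀ (s s' : Λ → Fin 2) (x : Fin 2), s ⟨k, hk⟩ = s' ⟨k, hk⟩ →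
      M (Function.update s ⟨k, hk⟩ x) (Function.update s' ⟨k, hk⟩ x) = M s s') (Y : SpinOp) :
    Commute M (siteOp Λ k Y) := by
  have hne : ∀ {n : Λ}, n ≠ ⟨k, hk⟩ → n.1 ≠ k := fun hn e => hn (Subtype.ext e)
  have hne' : ∀ {n : Λ}, n.1 ≠ k → n ≠ ⟨k, hk⟩ := fun hn e => hn (congrArg Subtype.val e)
  ext s s'
  rw [Matrix.mul_apply, Matrix.mul_apply,
    Finset.sum_eq_single (Function.update s' ⟨k, hk⟩ (s ⟨k, hk⟩)),
    Finset.sum_eq_single (Function.update s ⟨k, hk⟩ (s' ⟨k, hk⟩))]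
  · have e1 := h1 s (Function.update s' ⟨k, hk⟩ (s ⟨k, hk⟩)) (s' ⟨k, hk⟩) (by simp)
    rw [Function.update_idem, Function.update_eq_self] at e1
    rw [e1, mul_comm]
    congr 1
    simp only [siteOp, hk, dite_true, Function.update_self]
    rw [if_pos, if_pos]
    · intro n hn
      rw [Function.update_of_ne (hne' hn)]
    · intro n hn
      rw [Function.update_of_ne (hne' hn)]
  · intro u _ hu
    simp only [siteOp, hk, dite_true]
    split_ifs with h
    · rw [h0 u s', mul_zero]
      intro hk'
      refine hu (funext fun n => ?_)
      by_cases hn : n = ⟨k, hk⟩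
      · subst hn; simp [hk']
      · rw [Function.update_of_ne hn, h n (hne hn)]
    · rw [zero_mul]
  · simp
  · intro u _ hu
    simp only [siteOp, hk, dite_true]
    split_ifs with h
    · rw [h0 s u, zero_mul]
      intro hk'
      refine hu (funext fun n => ?_)
      by_cases hn : n = ⟨k, hk⟩
      · subst hn; simp [hk']
      · rw [Function.update_of_ne hn, h n (hne hn)]
    · rw [mul_zero]
  · simp

lemma commute_siteOp (h : k ≠ k') (X Y : SpinOp) :
    Commute (siteOp Λ k X) (siteOp Λ k' Y) := by
  by_cases hk : k ∈ Λ
  swap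
  · rw [siteOp_of_notMem hk]; exact Commute.zero_left _
  by_cases hk' : k' ∈ Λ
  swap
  · rw [siteOp_of_notMem hk']; exact Commute.zero_right _
  have hne : (⟨k, hk⟩ : Λ) ≠ ⟨k', hk'⟩ := fun e => h (congrArg Subtype.val e)
  refine commute_siteOp_of_forall hk' ?_ ?_ Y
  · intro s s' hs
    simp only [siteOp, hk, dite_true]
    rw [if_neg fun hall => hs (hall ⟨k', hk'⟩ h.symm)]
  · intro s s' x hs
    simp only [siteOp, hk, dite_true, Function.update_of_ne hne]
    congr 1
    refine propext (forall_congr' fun n => imp_congr_right fun _ => ?_)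
    by_cases hn : n = ⟨k', hk'⟩
    · subst hn; simp [hs]
    · simp [Function.update_of_ne hn]

/-- Splitting of the configurations of `Λ'` into those of `Λ ⊆ Λ'` and of its complement. -/
def splitConfig (h : Λ ⊆ Λ') :
    (Λ' → Fin 2) ≃ (Λ → Fin 2) × ({n : Λ' // n.1 ∉ Λ} → Fin 2) where
  toFun s := (fun n => s ⟨n.1, h n.2⟩, fun n => s n.1)
  invFun p := fun n => if hn : n.1 ∈ Λ then p.1 ⟨n.1, hn⟩ else p.2 ⟨n, hn⟩
  left_inv s := by
    funext n
    by_cases hn : n.1 ∈ Λ <;> simp [hn]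
  right_inv p := by
    refine Prod.ext (funext fun n => ?_) (funext fun n => ?_)
    · simp
    · simp [n.2]

/-- The embedding `O ↦ O ⊗ 1` of the operators on `Λ` into those on `Λ' ⊇ Λ`. -/
def embed (h : Λ ⊆ Λ') : Op Λ →⋆ₐ[ℂ] Op Λ' := ampl (splitConfig h)

lemma norm_embed (h : Λ ⊆ Λ') (O : Op Λ) : ‖embed h O‖ = ‖O‖ := norm_ampl _ _

lemma embed_conjTranspose (h : Λ ⊆ Λ') (O : Op Λ) : embed h Oᴴ = (embed h O)ᴴ :=
  map_star (embed h) O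

lemma embed_apply (h : Λ ⊆ Λ') (O : Op Λ) (s s' : Λ' → Fin 2) :
    embed h O s s' = if ∀ n : Λ', n.1 ∉ Λ → s n = s' n then
      O (fun n => s ⟨n.1, h n.2⟩) (fun n => s' ⟨n.1, h n.2⟩) else 0 := by
  rw [embed, ampl_apply]
  simp only [splitConfig, Equiv.coe_fn_mk]
  congr 1
  simp only [funext_iff, Subtype.forall]

lemma embed_siteOp (h : Λ ⊆ Λ') (hk : k ∈ Λ) (X : SpinOp) :
    embed h (siteOp Λ k X) = siteOp Λ' k X := by
  ext s s'
  rw [embed_apply]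
  simp only [siteOp, hk, h hk, dite_true]
  rw [← ite_and]
  congr 1
  refine propext ⟨fun ⟨h1, h2⟩ n hn => ?_, fun h1 => ⟨fun n hn => h1 n fun e => hn (e ▸ hk),
    fun n hn => h1 _ hn⟩⟩
  by_cases hn' : n.1 ∈ Λ
  · exact h2 ⟨n.1, hn'⟩ hn
  · exact h1 n hn'

lemma commute_embed_siteOp (h : Λ ⊆ Λ') (hk : k ∉ Λ) (O : Op Λ) (X : SpinOp) :
    Commute (embed h O) (siteOp Λ' k X) := by
  by_cases hk' : k ∈ Λ'
  swap
  · rw [siteOp_of_notMem hk']; exact Commute.zero_right _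
  have hne : ∀ n : Λ, (⟨n.1, h n.2⟩ : Λ') ≠ ⟨k, hk'⟩ := fun n e =>
    hk (by rw [← show n.1 = k from congrArg Subtype.val e]; exact n.2)
  refine commute_siteOp_of_forall hk' ?_ ?_ X
  · intro s s' hs
    rw [embed_apply, if_neg fun hall => hs (hall ⟨k, hk'⟩ hk)]
  · intro s s' x hs
    simp only [embed_apply, Function.update_of_ne (hne _)]
    congr 1
    refine propext (forall_congr' fun n => imp_congr_right fun _ => ?_)
    by_cases hn : n = ⟨k, hk'⟩
    · subst hn; simp [hs]
    · simp [Function.update_of_ne hn]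

lemma trace_embed (h : Λ ⊆ Λ') (O : Op Λ) :
    (embed h O).trace = 2 ^ (Λ'.card - Λ.card) * O.trace := by
  have hc : Fintype.card ({n : Λ' // n.1 ∉ Λ}) = Λ'.card - Λ.card := by
    rw [← Finset.card_sdiff_of_subset h, Fintype.card_subtype]
    refine Finset.card_bij (fun n _ => n.1) ?_ ?_ ?_
    · intro n hn
      simpa using hn
    · intro n _ n' _ e
      exact Subtype.ext e
    · intro n hn
      rw [Finset.mem_sdiff] at hn
      exact ⟨⟨n, hn.1⟩, by simpa using hn.2, rfl⟩
  rw [embed, trace_ampl]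
  simp [hc]

end SiteOperators

/-! ### Splitting the generator into sites and bonds -/

section ChainGenerators

variable {m : ℕ} (L : Fin m → SpinOp) (Γ : ℝ) (Λ : Finset ℤ)

/-- The Hamiltonian of the fields at the site `k`. -/
def fieldTerm (k : ℤ) : Op Λ :=
  -(((-1.05 : ℝ) : ℂ) • siteOp Λ k pauliX + ((0.5 : ℝ) : ℂ) • siteOp Λ k pauliZ)

/-- The interaction across the bond `{b, b + 1}`. -/
def bondTerm (b : ℤ) : Op Λ := -(siteOp Λ b pauliZ * siteOp Λ (b + 1) pauliZ)

/-- The dissipative part of the generator at the site `k`, at unit rate. -/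
def siteDissipator (k : ℤ) (O : Op Λ) : Op Λ := ∑ α, dissipator (siteOp Λ k (L α)) O

/-- The on-site part of the generator at the site `k`. -/
def siteGen (k : ℤ) (O : Op Λ) : Op Λ :=
  hamGen (fieldTerm Λ k) O + ((Γ / 2 : ℝ) : ℂ) • siteDissipator L Λ k O

/-- The bonds of `Λ`, labelled by their left ends. -/
def bonds : Finset ℤ := {b ∈ Λ | b + 1 ∈ Λ}

variable {L Γ Λ}

lemma mem_bonds {b : ℤ} : b ∈ bonds Λ ↔ b ∈ Λ ∧ b + 1 ∈ Λ := by simp [bonds]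

lemma chaoticIsing_eq :
    chaoticIsing Λ = ∑ b ∈ bonds Λ, bondTerm Λ b + ∑ k ∈ Λ, fieldTerm Λ k := by
  simp only [chaoticIsing, isingHamiltonian, bondTerm, fieldTerm, bonds, Finset.sum_neg_distrib,
    sub_eq_add_neg]

lemma adjLiouvillian_apply (O : Op Λ) :
    adjLiouvillian L Γ Λ O = hamGen (chaoticIsing Λ) O
      + ((Γ / 2 : ℝ) : ℂ) • ∑ k ∈ Λ, siteDissipator L Λ k O := rfl

/-- All dissipation sits in the on-site part, while only the bond part can spread influence between
sites. -/
lemma adjLiouvillian_eq_sum (O : Op Λ) :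
    adjLiouvillian L Γ Λ O
      = ∑ k ∈ Λ, siteGen L Γ Λ k O + ∑ b ∈ bonds Λ, hamGen (bondTerm Λ b) O := by
  rw [adjLiouvillian_apply, chaoticIsing_eq, hamGen_add, hamGen_sum, hamGen_sum]
  simp only [siteGen, Finset.sum_add_distrib, Finset.smul_sum]
  abel

lemma pauliX_conjTranspose : pauliXᴴ = pauliX := by
  ext i j; fin_cases i <;> fin_cases j <;> simp [pauliX]

lemma pauliZ_conjTranspose : pauliZᴴ = pauliZ := by
  ext i j; fin_cases i <;> fin_cases j <;> simp [pauliZ]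

lemma norm_pauliZ : ‖pauliZ‖ = 1 := by
  have h : pauliZᴴ * pauliZ = 1 := by
    ext i j; fin_cases i <;> fin_cases j <;> simp [pauliZ, Matrix.mul_apply]
  have h2 := Matrix.l2_opNorm_conjTranspose_mul_self pauliZ
  rw [h, CStarRing.norm_one] at h2
  nlinarith [norm_nonneg pauliZ]

lemma fieldTerm_conjTranspose (k : ℤ) : (fieldTerm Λ k)ᴴ = fieldTerm Λ k := by
  simp only [fieldTerm, Matrix.conjTranspose_neg, Matrix.conjTranspose_add,
    Matrix.conjTranspose_smul, siteOp_conjTranspose, pauliX_conjTranspose, pauliZ_conjTranspose,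
    RCLike.star_def, Complex.conj_ofReal]

lemma bondTerm_conjTranspose (b : ℤ) : (bondTerm Λ b)ᴴ = bondTerm Λ b := by
  simp only [bondTerm, Matrix.conjTranspose_neg, Matrix.conjTranspose_mul, siteOp_conjTranspose,
    pauliZ_conjTranspose]
  rw [(commute_siteOp (by omega : b ≠ b + 1) pauliZ pauliZ).eq]

lemma chaoticIsing_conjTranspose : (chaoticIsing Λ)ᴴ = chaoticIsing Λ := by
  simp only [chaoticIsing_eq, Matrix.conjTranspose_add, Matrix.conjTranspose_sum,
    fieldTerm_conjTranspose, bondTerm_conjTranspose]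

lemma diniLE_norm_siteGen (hΓ : 0 ≤ Γ) (k : ℤ) :
    DiniLE (normSeminorm ℂ (Op Λ)) (siteGen L Γ Λ k) (fun _ => 0) := by
  have h1 := DiniLE.sum (p := normSeminorm ℂ (Op Λ)) Finset.univ
    fun α _ => diniLE_norm_dissipator (siteOp Λ k (L α))
  have h1' : DiniLE (normSeminorm ℂ (Op Λ)) (siteDissipator L Λ k) fun _ => 0 := by
    simp only [Finset.sum_const_zero] at h1
    exact h1
  have h2 := (diniLE_norm_hamGen (fieldTerm_conjTranspose (Λ := Λ) k)).add
    (h1'.smul (by positivity : 0 ≤ Γ / 2))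
  simp only [add_zero] at h2
  exact h2

lemma diniLE_norm_adjLiouvillian (hΓ : 0 ≤ Γ) :
    DiniLE (normSeminorm ℂ (Op Λ)) (adjLiouvillian L Γ Λ) (fun _ => 0) := by
  have h := (DiniLE.sum Λ fun k _ => diniLE_norm_siteGen (L := L) (Λ := Λ) hΓ k).add
    (DiniLE.sum (bonds Λ) fun b _ => diniLE_norm_hamGen (bondTerm_conjTranspose (Λ := Λ) b))
  simp only [← adjLiouvillian_eq_sum, Finset.sum_const_zero, add_zero] at h
  exact h

lemma normSeminorm_le_mul (O : Op Λ) : normSeminorm ℂ (Op Λ) O ≤ 1 * ‖O‖ := by simp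

lemma hasDerivAt_heisenberg (O : Op Λ) (t : ℝ) :
    HasDerivAt (fun s => heisenberg L Γ Λ s O) (adjLiouvillian L Γ Λ (heisenberg L Γ Λ t O)) t :=
  hasDerivAt_propagator _ _ _

lemma heisenberg_zero (O : Op Λ) : heisenberg L Γ Λ 0 O = O := propagator_zero _ _

lemma norm_heisenberg_le (hΓ : 0 ≤ Γ) {t : ℝ} (ht : 0 ≤ t) (O : Op Λ) :
    ‖heisenberg L Γ Λ t O‖ ≤ ‖O‖ := by
  have := (diniLE_norm_adjLiouvillian (L := L) (Λ := Λ) hΓ).le_of_hasDerivAt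
    normSeminorm_le_mul (y := fun s => heisenberg L Γ Λ s O) (g := fun _ => 0)
    (Φ := fun _ => ‖O‖) (Φ' := fun _ => 0) ht
    (fun s => by simpa using hasDerivAt_heisenberg O s) (by simp [heisenberg_zero])
    (fun s => hasDerivAt_const _ _) (by simp)
  simpa using this

lemma heisenberg_apply_zero (t : ℝ) : heisenberg L Γ Λ t 0 = 0 := map_zero (propagator _ t)

end ChainGenerators

/-! ### Influence on a site as distance from its commutant -/

section SiteDistance

variable {Λ : Finset ℤ} {i k : ℤ}

/-- The commutant of the operators at the site `i`. -/
def siteCommutant (Λ : Finset ℤ) (i : ℤ) : Subalgebra ℂ (Op Λ) :=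
  Subalgebra.centralizer ℂ (Set.range (siteOp Λ i))

lemma mem_siteCommutant {X : Op Λ} : X ∈ siteCommutant Λ i ↔ ∀ A, Commute (siteOp Λ i A) X := by
  simp [siteCommutant, Subalgebra.mem_centralizer_iff, Commute, SemiconjBy]

lemma siteOp_mem_siteCommutant (h : k ≠ i) (X : SpinOp) : siteOp Λ k X ∈ siteCommutant Λ i :=
  mem_siteCommutant.2 fun A => commute_siteOp h.symm A X

/-- A finite-dimensional subspace is closed, so a nearest point exists in finite dimension. -/
lemma exists_siteCommutant_infDist (i : ℤ) (O : Op Λ) : ∃ X ∈ siteCommutant Λ i,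
    Metric.infDist O (siteCommutant Λ i : Set (Op Λ)) = ‖O - X‖ := by
  have hc : IsClosed (siteCommutant Λ i : Set (Op Λ)) :=
    (Subalgebra.toSubmodule (siteCommutant Λ i)).closed_of_finiteDimensional
  obtain ⟨X, hX, h⟩ := hc.exists_infDist_eq_dist ⟨0, zero_mem _⟩ O
  exact ⟨X, hX, h.trans (dist_eq_norm _ _)⟩

/-- The distance of `O` from the commutant of the site `i`: a measure for the influence of `O` on
that site. -/
def siteDist (Λ : Finset ℤ) (i : ℤ) : Seminorm ℂ (Op Λ) :=
  Seminorm.ofSMulLE (fun O => Metric.infDist O (siteCommutant Λ i : Set (Op Λ)))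
    (Metric.infDist_zero_of_mem (zero_mem _))
    (fun O O' => by
      obtain ⟨X, hX, h⟩ := exists_siteCommutant_infDist i O
      obtain ⟨X', hX', h'⟩ := exists_siteCommutant_infDist i O'
      rw [h, h']
      refine (Metric.infDist_le_dist_of_mem (add_mem hX hX')).trans ?_
      rw [dist_eq_norm, add_sub_add_comm]
      exact norm_add_le _ _)
    (fun r O => by
      obtain ⟨X, hX, h⟩ := exists_siteCommutant_infDist i O
      rw [h]
      refine (Metric.infDist_le_dist_of_mem (Subalgebra.smul_mem _ hX r)).trans ?_
      rw [dist_eq_norm, ← smul_sub, norm_smul])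

lemma siteDist_le {X : Op Λ} (hX : X ∈ siteCommutant Λ i) (O : Op Λ) :
    siteDist Λ i O ≤ ‖O - X‖ :=
  (Metric.infDist_le_dist_of_mem hX).trans (dist_eq_norm _ _).le

lemma siteDist_le_norm (O : Op Λ) : siteDist Λ i O ≤ ‖O‖ := by
  simpa using siteDist_le (zero_mem (siteCommutant Λ i)) O

lemma exists_siteDist_eq (i : ℤ) (O : Op Λ) : ∃ X ∈ siteCommutant Λ i, siteDist Λ i O = ‖O - X‖ :=
  exists_siteCommutant_infDist i O

lemma siteDist_siteOp_of_ne (h : k ≠ i) (X : SpinOp) : siteDist Λ i (siteOp Λ k X) = 0 :=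
  le_antisymm (by simpa using siteDist_le (siteOp_mem_siteCommutant h X) (siteOp Λ k X))
    (apply_nonneg _ _)

lemma norm_commutator_siteOp_le (O : Op Λ) (A : SpinOp) :
    ‖O * siteOp Λ i A - siteOp Λ i A * O‖ ≤ 2 * ‖A‖ * siteDist Λ i O := by
  obtain ⟨X, hX, h⟩ := exists_siteDist_eq i O
  have e : O * siteOp Λ i A - siteOp Λ i A * O
      = (O - X) * siteOp Λ i A - siteOp Λ i A * (O - X) := by
    rw [sub_mul, mul_sub, (mem_siteCommutant.1 hX A).eq]
    abel
  rw [e, h]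
  have hA := norm_siteOp_le (Λ := Λ) (k := i) A
  calc _ ≤ ‖O - X‖ * ‖siteOp Λ i A‖ + ‖siteOp Λ i A‖ * ‖O - X‖ :=
        (norm_sub_le _ _).trans (add_le_add (norm_mul_le _ _) (norm_mul_le _ _))
    _ ≤ ‖O - X‖ * ‖A‖ + ‖A‖ * ‖O - X‖ := by gcongr
    _ = _ := by ring

/-- If X is nearest to O in the commutant, then X + s·G X is still in the commutant and competes for
the distance of O + s·G O. The contraction is applied to O - X. -/
lemma DiniLE.siteDist {G : Op Λ → Op Λ} (h : DiniLE (normSeminorm ℂ (Op Λ)) G fun _ => 0)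
    (hG : ∀ x y, G (x + y) = G x + G y)
    (hmem : ∀ X ∈ siteCommutant Λ i, G X ∈ siteCommutant Λ i) :
    DiniLE (siteDist Λ i) G fun _ => 0 := by
  intro O η hη
  obtain ⟨X, hX, hO⟩ := exists_siteDist_eq i O
  filter_upwards [h (O - X) η hη] with s hs
  rw [hO]
  refine (siteDist_le (add_mem hX (Subalgebra.smul_mem _ (hmem X hX) (s : ℂ))) _).trans ?_
  have e : G O = G (O - X) + G X := by rw [← hG, sub_add_cancel]
  rw [e, smul_add, show O + ((s : ℂ) • G (O - X) + (s : ℂ) • G X) - (X + (s : ℂ) • G X)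
    = O - X + (s : ℂ) • G (O - X) by abel]
  exact hs

lemma hamGen_add_right {n : Type*} [Fintype n] (h x y : Matrix n n ℂ) :
    hamGen h (x + y) = hamGen h x + hamGen h y := by
  simp only [hamGen, add_mul, mul_add]
  module

lemma dissipator_add_right {n : Type*} [Fintype n] (L x y : Matrix n n ℂ) :
    dissipator L (x + y) = dissipator L x + dissipator L y := by
  simp only [dissipator, add_mul, mul_add]
  module

lemma siteGen_add_right {m : ℕ} (L : Fin m → SpinOp) (Γ : ℝ) (x y : Op Λ) :
    siteGen L Γ Λ k (x + y) = siteGen L Γ Λ k x + siteGen L Γ Λ k y := by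
  simp only [siteGen, siteDissipator, hamGen_add_right, dissipator_add_right,
    Finset.sum_add_distrib, smul_add]
  abel

lemma hamGen_mem {S : Subalgebra ℂ (Op Λ)} {h X : Op Λ} (hh : h ∈ S) (hX : X ∈ S) :
    hamGen h X ∈ S :=
  Subalgebra.smul_mem _ (sub_mem (mul_mem hh hX) (mul_mem hX hh)) _

lemma dissipator_mem {S : Subalgebra ℂ (Op Λ)} {L X : Op Λ} (hL : L ∈ S) (hL' : Lᴴ ∈ S)
    (hX : X ∈ S) : dissipator L X ∈ S :=
  sub_mem (sub_mem (Subalgebra.smul_mem _ (mul_mem (mul_mem hL' hX) hL) _)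
    (mul_mem hX (mul_mem hL' hL))) (mul_mem (mul_mem hL' hL) hX)

lemma commute_fieldTerm {X : Op Λ} (h : ∀ A, Commute (siteOp Λ k A) X) :
    Commute (fieldTerm Λ k) X :=
  (((h _).smul_left _).add_left ((h _).smul_left _)).neg_left

lemma siteGen_eq_zero {m : ℕ} (L : Fin m → SpinOp) (Γ : ℝ) {X : Op Λ}
    (h : ∀ A, Commute (siteOp Λ k A) X) : siteGen L Γ Λ k X = 0 := by
  rw [siteGen, hamGen_eq_zero (commute_fieldTerm h), siteDissipator, Finset.sum_eq_zero, smul_zero,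
    add_zero]
  intro α _
  exact dissipator_eq_zero (h _) (by rw [siteOp_conjTranspose]; exact h _)

/-- At the site i itself the generator kills the commutant; at other sites it is built from elements
of the commutant. -/
lemma siteGen_mem {m : ℕ} (L : Fin m → SpinOp) (Γ : ℝ) {X : Op Λ}
    (hX : X ∈ siteCommutant Λ i) : siteGen L Γ Λ k X ∈ siteCommutant Λ i := by
  by_cases hk : k = i
  · subst hk
    rw [siteGen_eq_zero L Γ (mem_siteCommutant.1 hX)]
    exact zero_mem _
  · have hm : ∀ A, siteOp Λ k A ∈ siteCommutant Λ i := siteOp_mem_siteCommutant hk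
    refine add_mem (hamGen_mem ?_ hX) (Subalgebra.smul_mem _ (sum_mem fun α _ => ?_) _)
    · exact neg_mem (add_mem (Subalgebra.smul_mem _ (hm _) _) (Subalgebra.smul_mem _ (hm _) _))
    · exact dissipator_mem (hm _) (by rw [siteOp_conjTranspose]; exact hm _) hX

lemma hamGen_bondTerm_mem {b : ℤ} (h : b ≠ i) (h' : b + 1 ≠ i) {X : Op Λ}
    (hX : X ∈ siteCommutant Λ i) : hamGen (bondTerm Λ b) X ∈ siteCommutant Λ i :=
  hamGen_mem (neg_mem (mul_mem (siteOp_mem_siteCommutant h _) (siteOp_mem_siteCommutant h' _))) hX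

/-- The Leibniz rule reduces a bond to single-site commutators, which `siteDist` controls. -/
lemma hamGen_bondTerm_eq (b : ℤ) (O : Op Λ) : hamGen (bondTerm Λ b) O = Complex.I •
    (siteOp Λ b pauliZ * (O * siteOp Λ (b + 1) pauliZ - siteOp Λ (b + 1) pauliZ * O)
      + (O * siteOp Λ b pauliZ - siteOp Λ b pauliZ * O) * siteOp Λ (b + 1) pauliZ) := by
  rw [hamGen, bondTerm]
  congr 1
  noncomm_ring

lemma norm_hamGen_bondTerm_le_commutators (b : ℤ) (O : Op Λ) : ‖hamGen (bondTerm Λ b) O‖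
    ≤ ‖O * siteOp Λ (b + 1) pauliZ - siteOp Λ (b + 1) pauliZ * O‖
      + ‖O * siteOp Λ b pauliZ - siteOp Λ b pauliZ * O‖ := by
  have hZ : ∀ k, ‖siteOp Λ k pauliZ‖ ≤ 1 := fun k => (norm_siteOp_le _).trans norm_pauliZ.le
  rw [hamGen_bondTerm_eq, norm_smul, Complex.norm_I, one_mul]
  refine (norm_add_le _ _).trans (add_le_add ((norm_mul_le _ _).trans ?_)
    ((norm_mul_le _ _).trans ?_))
  · exact mul_le_of_le_one_left (norm_nonneg _) (hZ _)
  · exact mul_le_of_le_one_right (norm_nonneg _) (hZ _)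

lemma norm_hamGen_bondTerm_le (b : ℤ) (O : Op Λ) :
    ‖hamGen (bondTerm Λ b) O‖ ≤ 2 * (siteDist Λ b O + siteDist Λ (b + 1) O) := by
  refine (norm_hamGen_bondTerm_le_commutators b O).trans ?_
  have h1 := norm_commutator_siteOp_le (i := b) O pauliZ
  have h2 := norm_commutator_siteOp_le (i := b + 1) O pauliZ
  rw [norm_pauliZ] at h1 h2
  linarith

end SiteDistance

/-! ### Lieb-Robinson bound uniform in the dissipation -/

section LiebRobinsonBound

variable {m : ℕ} {L : Fin m → SpinOp} {Γ : ℝ} {Λ : Finset ℤ}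

/-- Bonds containing i are treated as bounded perturbations. Every other part of the generator
preserves the commutant of i and adds nothing. -/
lemma diniLE_siteDist_adjLiouvillian (hΓ : 0 ≤ Γ) (i : ℤ) :
    DiniLE (siteDist Λ i) (adjLiouvillian L Γ Λ) fun O => ∑ b ∈ bonds Λ,
      if i = b ∨ i = b + 1 then 2 * (siteDist Λ b O + siteDist Λ (b + 1) O) else 0 := by
  have h1 : DiniLE (siteDist Λ i) (fun O => ∑ k ∈ Λ, siteGen L Γ Λ k O) fun _ => 0 := by
    have := DiniLE.sum (p := siteDist Λ i) Λ fun k _ =>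
      (diniLE_norm_siteGen (L := L) (Λ := Λ) hΓ k).siteDist (siteGen_add_right L Γ)
        fun X hX => siteGen_mem L Γ hX
    simpa only [Finset.sum_const_zero] using this
  have h2 := DiniLE.sum (p := siteDist Λ i) (G := fun b => hamGen (bondTerm Λ b))
    (q := fun b O => if i = b ∨ i = b + 1 then 2 * (siteDist Λ b O + siteDist Λ (b + 1) O) else 0)
    (bonds Λ) fun b _ => by
      by_cases hb : i = b ∨ i = b + 1
      · simp only [hb, if_true]
        exact DiniLE.of_le fun O => (siteDist_le_norm _).trans (norm_hamGen_bondTerm_le b O)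
      · simp only [hb, if_false]
        rw [not_or] at hb
        exact (diniLE_norm_hamGen (bondTerm_conjTranspose (Λ := Λ) b)).siteDist
          (hamGen_add_right _) fun X hX => hamGen_bondTerm_mem (Ne.symm hb.1) (Ne.symm hb.2) hX
  have := h1.add h2
  simp only [← adjLiouvillian_eq_sum, zero_add] at this
  exact this

/-- The weight `exp |i - j|` in the Lieb-Robinson estimate. -/
def distWeight (j i : ℤ) : NNReal := ⟨Real.exp |(i : ℝ) - j|, (Real.exp_pos _).le⟩

lemma coe_distWeight (j i : ℤ) : (distWeight j i : ℝ) = Real.exp |(i : ℝ) - j| := rfl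

lemma distWeight_le_mul {i i' : ℤ} (j : ℤ) (h : |(i : ℝ) - i'| ≤ 1) :
    (distWeight j i : ℝ) ≤ Real.exp 1 * distWeight j i' := by
  rw [coe_distWeight, coe_distWeight, ← Real.exp_add]
  refine Real.exp_le_exp.2 ?_
  have := abs_sub_le (i : ℝ) i' j
  linarith

/-- The influence on all sites, weighted exponentially with the distance from `j`. -/
def weightedDist (Λ : Finset ℤ) (j : ℤ) : Seminorm ℂ (Op Λ) :=
  ∑ i ∈ Λ, distWeight j i • siteDist Λ i

lemma weightedDist_apply (j : ℤ) (O : Op Λ) :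
    weightedDist Λ j O = ∑ i ∈ Λ, distWeight j i * siteDist Λ i O := by
  have h : ∀ S : Finset ℤ, (∑ i ∈ S, distWeight j i • siteDist Λ i) O
      = ∑ i ∈ S, distWeight j i * siteDist Λ i O := by
    intro S
    induction S using Finset.induction_on with
    | empty => simp
    | insert a S ha ih =>
      rw [Finset.sum_insert ha, Finset.sum_insert ha, add_apply, ih]
      rfl
  exact h Λ

/-- After exchanging the sums, a bond feeds both of its ends, whose weights differ by a factor at
most e: this gives 2(1 + e). Each site lies in at most two bonds, which doubles the rate. -/
lemma diniLE_weightedDist_adjLiouvillian (hΓ : 0 ≤ Γ) (j : ℤ) :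
    DiniLE (weightedDist Λ j) (adjLiouvillian L Γ Λ)
      fun O => 4 * (1 + Real.exp 1) * weightedDist Λ j O := by
  refine (DiniLE.seminorm_sum Λ fun i _ =>
    (diniLE_siteDist_adjLiouvillian (L := L) (Λ := Λ) hΓ i).seminorm_smul
      (distWeight j i)).mono fun O => ?_
  have hw : ∀ k, 0 ≤ (distWeight j k : ℝ) * siteDist Λ k O := fun k =>
    mul_nonneg (NNReal.coe_nonneg _) (apply_nonneg _ _)
  have hb : ∀ b ∈ bonds Λ, ∑ i ∈ Λ, (distWeight j i : ℝ) *
      (if i = b ∨ i = b + 1 then 2 * (siteDist Λ b O + siteDist Λ (b + 1) O) else 0)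
      ≤ 2 * (1 + Real.exp 1) * (distWeight j b * siteDist Λ b O)
        + 2 * (1 + Real.exp 1) * (distWeight j (b + 1) * siteDist Λ (b + 1) O) := by
    intro b hb
    have hsub : ({b, b + 1} : Finset ℤ) ⊆ Λ := by
      intro x hx
      rw [mem_bonds] at hb
      simp only [Finset.mem_insert, Finset.mem_singleton] at hx
      rcases hx with rfl | rfl
      exacts [hb.1, hb.2]
    rw [← Finset.sum_subset hsub, Finset.sum_pair (by omega)]
    · simp only [true_or, or_true, if_true]
      have h1 := distWeight_le_mul (i := b) (i' := b + 1) j (by push_cast; simp)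
      have h2 := distWeight_le_mul (i := b + 1) (i' := b) j (by push_cast; simp)
      have h3 : 0 ≤ siteDist Λ b O := apply_nonneg _ _
      have h4 : 0 ≤ siteDist Λ (b + 1) O := apply_nonneg _ _
      nlinarith [mul_le_mul_of_nonneg_right h1 h4, mul_le_mul_of_nonneg_right h2 h3]
    · intro i _ hi
      simp only [Finset.mem_insert, Finset.mem_singleton] at hi
      rw [if_neg hi, mul_zero]
  calc ∑ i ∈ Λ, (distWeight j i : ℝ) * ∑ b ∈ bonds Λ,
      (if i = b ∨ i = b + 1 then 2 * (siteDist Λ b O + siteDist Λ (b + 1) O) else 0)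
      = ∑ b ∈ bonds Λ, ∑ i ∈ Λ, (distWeight j i : ℝ) *
        (if i = b ∨ i = b + 1 then 2 * (siteDist Λ b O + siteDist Λ (b + 1) O) else 0) := by
        simp only [Finset.mul_sum]
        exact Finset.sum_comm
    _ ≤ _ := Finset.sum_le_sum hb
    -- Right ends are reindexed by a shift, so that both sums run over subsets of Λ.
    _ = 2 * (1 + Real.exp 1) * ∑ b ∈ bonds Λ, distWeight j b * siteDist Λ b O
        + 2 * (1 + Real.exp 1) * ∑ b ∈ (bonds Λ).map (addRightEmbedding 1),
          distWeight j b * siteDist Λ b O := by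
        rw [Finset.sum_add_distrib, Finset.sum_map, Finset.mul_sum, Finset.mul_sum]
        rfl
    _ ≤ 2 * (1 + Real.exp 1) * weightedDist Λ j O + 2 * (1 + Real.exp 1) * weightedDist Λ j O := by
        rw [weightedDist_apply]
        refine add_le_add (mul_le_mul_of_nonneg_left ?_ (by positivity))
          (mul_le_mul_of_nonneg_left ?_ (by positivity))
        · exact Finset.sum_le_sum_of_subset_of_nonneg (Finset.filter_subset _ _) fun k _ _ => hw k
        · refine Finset.sum_le_sum_of_subset_of_nonneg ?_ fun k _ _ => hw k
          intro k hk
          rw [Finset.mem_map] at hk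
          obtain ⟨b, hb, rfl⟩ := hk
          exact (mem_bonds.1 hb).2
    _ = _ := by ring

lemma weightedDist_siteOp_le (j : ℤ) (B : SpinOp) : weightedDist Λ j (siteOp Λ j B) ≤ ‖B‖ := by
  rw [weightedDist_apply]
  calc _ ≤ ∑ i ∈ Λ, if i = j then ‖B‖ else 0 := by
        refine Finset.sum_le_sum fun i _ => ?_
        split_ifs with h
        · subst h
          rw [coe_distWeight, sub_self, abs_zero, Real.exp_zero, one_mul]
          exact (siteDist_le_norm _).trans (norm_siteOp_le _)
        · rw [siteDist_siteOp_of_ne (Ne.symm h), mul_zero]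
    _ ≤ ‖B‖ := by
        rw [Finset.sum_ite_eq']
        split_ifs
        exacts [le_rfl, norm_nonneg _]

/-- Initially only the site j contributes to the weighted sum, with weight 1. Grönwall bounds its
growth, and the single term at i yields the decay. -/
lemma siteDist_heisenberg_le (hΓ : 0 ≤ Γ) {i : ℤ} (hi : i ∈ Λ) (j : ℤ) (B : SpinOp) {t : ℝ}
    (ht : 0 ≤ t) : siteDist Λ i (heisenberg L Γ Λ t (siteOp Λ j B))
      ≤ ‖B‖ * Real.exp (4 * (1 + Real.exp 1) * t - |(i : ℝ) - j|) := by
  have hM : ∀ O : Op Λ, weightedDist Λ j O ≤ (∑ i ∈ Λ, (distWeight j i : ℝ)) * ‖O‖ := by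
    intro O
    rw [weightedDist_apply, Finset.sum_mul]
    exact Finset.sum_le_sum fun i _ => by gcongr; exact siteDist_le_norm O
  have h := (diniLE_weightedDist_adjLiouvillian (L := L) (Λ := Λ) hΓ j).le_exp_of_hasDerivAt hM
    (y := fun s => heisenberg L Γ Λ s (siteOp Λ j B)) ht fun s => hasDerivAt_heisenberg _ s
  have h1 : (distWeight j i : ℝ) * siteDist Λ i (heisenberg L Γ Λ t (siteOp Λ j B))
      ≤ weightedDist Λ j (heisenberg L Γ Λ t (siteOp Λ j B)) := by
    rw [weightedDist_apply]
    exact Finset.single_le_sum (f := fun i => (distWeight j i : ℝ) * siteDist Λ i _)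
      (fun k _ => mul_nonneg (NNReal.coe_nonneg _) (apply_nonneg _ _)) hi
  have h2 := h1.trans h
  rw [heisenberg_zero] at h2
  have h3 := h2.trans (mul_le_mul_of_nonneg_right (weightedDist_siteOp_le j B) (Real.exp_pos _).le)
  rw [Real.exp_sub, mul_div_assoc', le_div_iff₀ (Real.exp_pos _), mul_comm, ← coe_distWeight]
  exact h3

theorem liebRobinson_of_nonneg (L : Fin m → SpinOp) (hΓ : 0 ≤ Γ) {a : ℝ} (ha : 0 < a) :
    LiebRobinson L Γ a (4 * (1 + Real.exp 1) * a) a 2 := by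
  intro l r i j hi _ A B t ht
  refine (norm_commutator_siteOp_le _ A).trans ?_
  have h := siteDist_heisenberg_le (L := L) hΓ hi j B ht
  have e : -(a * |(i : ℝ) - j| - 4 * (1 + Real.exp 1) * a * t) / a
      = 4 * (1 + Real.exp 1) * t - |(i : ℝ) - j| := by
    field_simp
    ring
  rw [e]
  calc _ ≤ 2 * ‖A‖ * (‖B‖ * Real.exp (4 * (1 + Real.exp 1) * t - |(i : ℝ) - j|)) := by gcongr
    _ = _ := by ring

end LiebRobinsonBound

/-! ### The Hilbert-Schmidt norm -/

section HilbertSchmidt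

variable {n : Type*} [Fintype n]

/-- The Hilbert-Schmidt norm. -/
def hsNorm (O : Matrix n n ℂ) : ℝ := √((O * Oᴴ).trace.re)

lemma trace_mul_conjTranspose_re (O : Matrix n n ℂ) :
    (O * Oᴴ).trace.re = ∑ i, ∑ j, ‖O i j‖ ^ 2 := by
  simp only [Matrix.trace, Matrix.diag_apply, Matrix.mul_apply, Matrix.conjTranspose_apply,
    Complex.re_sum]
  refine Finset.sum_congr rfl fun i _ => Finset.sum_congr rfl fun j _ => ?_
  rw [RCLike.star_def, Complex.mul_conj, Complex.ofReal_re, Complex.normSq_eq_norm_sq]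

lemma hsNorm_eq (O : Matrix n n ℂ) :
    hsNorm O = ‖(WithLp.toLp 2 (fun p : n × n => O p.1 p.2) : EuclideanSpace ℂ (n × n))‖ := by
  rw [hsNorm, trace_mul_conjTranspose_re, EuclideanSpace.norm_eq, Fintype.sum_prod_type]

lemma hsNorm_sq (O : Matrix n n ℂ) : hsNorm O ^ 2 = ∑ i, ∑ j, ‖O i j‖ ^ 2 := by
  rw [hsNorm, Real.sq_sqrt, trace_mul_conjTranspose_re]
  rw [trace_mul_conjTranspose_re]
  positivity

lemma hsNorm_nonneg (O : Matrix n n ℂ) : 0 ≤ hsNorm O := Real.sqrt_nonneg _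

lemma hsNorm_sub_le (O O' : Matrix n n ℂ) : hsNorm (O - O') ≤ hsNorm O + hsNorm O' := by
  rw [hsNorm_eq, hsNorm_eq, hsNorm_eq]
  exact norm_sub_le (WithLp.toLp 2 (fun p : n × n => O p.1 p.2) : EuclideanSpace ℂ (n × n))
    (WithLp.toLp 2 (fun p : n × n => O' p.1 p.2))

lemma abs_hsNorm_sub_le (O O' : Matrix n n ℂ) : |hsNorm O - hsNorm O'| ≤ hsNorm (O - O') := by
  rw [hsNorm_eq, hsNorm_eq, hsNorm_eq]
  exact abs_norm_sub_norm_le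
    (WithLp.toLp 2 (fun p : n × n => O p.1 p.2) : EuclideanSpace ℂ (n × n))
    (WithLp.toLp 2 (fun p : n × n => O' p.1 p.2))

lemma hsNorm_conjTranspose (O : Matrix n n ℂ) : hsNorm Oᴴ = hsNorm O := by
  rw [hsNorm, hsNorm, trace_mul_conjTranspose_re, trace_mul_conjTranspose_re, Finset.sum_comm]
  simp

variable [DecidableEq n]

/-- A acts on each column of O as on a Euclidean vector. -/
lemma hsNorm_mul_le (A O : Matrix n n ℂ) : hsNorm (A * O) ≤ ‖A‖ * hsNorm O := by
  refine le_of_sq_le_sq ?_ (mul_nonneg (norm_nonneg _) (hsNorm_nonneg _))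
  rw [mul_pow, hsNorm_sq, hsNorm_sq, Finset.sum_comm, Finset.sum_comm (f := fun i j => ‖O i j‖ ^ 2),
    Finset.mul_sum]
  refine Finset.sum_le_sum fun j _ => ?_
  have h := Matrix.l2_opNorm_mulVec A (WithLp.toLp 2 (fun i => O i j))
  have h2 := pow_le_pow_left₀ (norm_nonneg _) h 2
  rw [mul_pow, EuclideanSpace.norm_sq_eq, EuclideanSpace.norm_sq_eq] at h2
  exact h2

lemma hsNorm_mul_le' (O A : Matrix n n ℂ) : hsNorm (O * A) ≤ hsNorm O * ‖A‖ := by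
  rw [← hsNorm_conjTranspose, Matrix.conjTranspose_mul, ← hsNorm_conjTranspose O, mul_comm,
    ← Matrix.l2_opNorm_conjTranspose A]
  exact hsNorm_mul_le _ _

lemma hsNorm_one : hsNorm (1 : Matrix n n ℂ) = √(Fintype.card n) := by
  simp [hsNorm]

lemma norm_le_hsNorm (O : Matrix n n ℂ) : ‖O‖ ≤ hsNorm O := by
  rw [Matrix.l2_opNorm_def]
  refine ContinuousLinearMap.opNorm_le_bound _ (hsNorm_nonneg _) fun x => ?_
  refine le_of_sq_le_sq ?_ (mul_nonneg (hsNorm_nonneg _) (norm_nonneg _))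
  rw [mul_pow, hsNorm_sq, EuclideanSpace.norm_sq_eq, EuclideanSpace.norm_sq_eq, Finset.sum_mul]
  refine Finset.sum_le_sum fun i _ => ?_
  calc _ ≤ (∑ j, ‖O i j‖ * ‖x j‖) ^ 2 := by
        refine pow_le_pow_left₀ (norm_nonneg _) ?_ 2
        refine (norm_sum_le _ _).trans (le_of_eq ?_)
        simp
    _ ≤ _ := Finset.sum_mul_sq_le_sq_mul_sq _ _ _

end HilbertSchmidt

/-! ### Common properties of the two norms -/

namespace NormKind

variable {Λ Λ' : Finset ℤ} (κ : NormKind)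

lemma norm_operator (O : Op Λ) : NormKind.operator.norm O = ‖O‖ := rfl

lemma norm_frobenius (O : Op Λ) : NormKind.frobenius.norm O = hsNorm O / √(2 ^ Λ.card) :=
  Real.sqrt_div' _ (by positivity)

protected lemma norm_nonneg (O : Op Λ) : 0 ≤ κ.norm O := by
  cases κ
  · exact norm_nonneg O
  · exact Real.sqrt_nonneg _

protected lemma norm_zero : κ.norm (0 : Op Λ) = 0 := by
  cases κ
  · exact norm_zero
  · simp [NormKind.norm]

lemma norm_le_opNorm (O : Op Λ) : κ.norm O ≤ ‖O‖ := by
  cases κ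
  · exact le_rfl
  · rw [norm_frobenius, div_le_iff₀ (by positivity)]
    have := hsNorm_mul_le O 1
    rwa [mul_one, hsNorm_one, Fintype.card_fun, Fintype.card_coe, Fintype.card_fin,
      Nat.cast_pow, Nat.cast_ofNat] at this

/-- This lets operator-norm estimates of differences serve both norms. -/
lemma abs_norm_sub_le (O O' : Op Λ) : |κ.norm O - κ.norm O'| ≤ ‖O - O'‖ := by
  cases κ
  · exact abs_norm_sub_norm_le _ _
  · refine le_trans ?_ (norm_le_opNorm .frobenius (O - O'))
    rw [norm_frobenius, norm_frobenius, norm_frobenius, ← sub_div, abs_div,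
      abs_of_nonneg (Real.sqrt_nonneg _)]
    gcongr
    exact abs_hsNorm_sub_le _ _

lemma norm_opCommutator_le (O A : Op Λ) : κ.norm (opCommutator O A) ≤ 2 * ‖A‖ * κ.norm O := by
  cases κ
  · refine (norm_sub_le _ _).trans ?_
    have h1 := norm_mul_le O A
    have h2 := norm_mul_le A O
    rw [norm_operator]
    linarith
  · rw [norm_frobenius, norm_frobenius, mul_div_assoc']
    gcongr
    refine (hsNorm_sub_le _ _).trans ?_
    have h1 := hsNorm_mul_le' O A
    have h2 := hsNorm_mul_le A O
    linarith

lemma norm_embed (h : Λ ⊆ Λ') (O : Op Λ) : κ.norm (embed h O) = κ.norm O := by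
  cases κ
  · exact _root_.norm_embed h O
  · simp only [NormKind.norm]
    rw [← embed_conjTranspose, ← map_mul, trace_embed]
    congr 1
    have hc := Finset.card_le_card h
    have : ((2 : ℂ) ^ (Λ'.card - Λ.card)) = ((2 ^ (Λ'.card - Λ.card) : ℝ) : ℂ) := by push_cast; rfl
    rw [this, Complex.re_ofReal_mul]
    rw [show (2 : ℝ) ^ Λ'.card = 2 ^ (Λ'.card - Λ.card) * 2 ^ Λ.card by
      rw [← pow_add, Nat.sub_add_cancel hc]]
    exact mul_div_mul_left _ _ (by positivity)

/-- The loss √2 comes from the Frobenius case: the normalization reduces to that of one spin, and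
the Hilbert-Schmidt norm dominates the operator norm. It is independent of the chain length. -/
lemma norm_siteOp_ge {j : ℤ} (hj : j ∈ Λ) (B : SpinOp) : ‖B‖ / √2 ≤ κ.norm (siteOp Λ j B) := by
  cases κ
  · rw [norm_operator, norm_siteOp hj]
    refine div_le_self (norm_nonneg _) ?_
    rw [Real.one_le_sqrt]
    norm_num
  · have h1 : ((siteOp Λ j B) * (siteOp Λ j B)ᴴ).trace
        = ((2 ^ (Λ.card - 1) : ℝ) : ℂ) * (B * Bᴴ).trace := by
      rw [siteOp_conjTranspose, siteOp_mul, siteOp_of_mem hj, trace_ampl]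
      simp
    have hc : 0 < Λ.card := Finset.card_pos.2 ⟨j, hj⟩
    have h2 : NormKind.frobenius.norm (siteOp Λ j B) = hsNorm B / √2 := by
      simp only [NormKind.norm, hsNorm]
      rw [h1, Complex.re_ofReal_mul, show (2 : ℝ) ^ Λ.card = 2 ^ (Λ.card - 1) * 2 by
        rw [← pow_succ, Nat.sub_add_cancel hc], mul_div_mul_left _ _ (by positivity),
        Real.sqrt_div' _ (by norm_num)]
    rw [h2]
    gcongr
    exact norm_le_hsNorm B

end NormKind

/-! ### Convergence along increasing chains -/

section ThermodynamicLimit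

variable {m : ℕ} {L : Fin m → SpinOp} {Γ : ℝ} {Λ Λ' : Finset ℤ}

lemma embed_hamGen (h : Λ ⊆ Λ') (H O : Op Λ) :
    embed h (hamGen H O) = hamGen (embed h H) (embed h O) := by
  simp only [hamGen, map_smul, map_sub, map_mul]

lemma embed_dissipator (h : Λ ⊆ Λ') (X O : Op Λ) :
    embed h (dissipator X O) = dissipator (embed h X) (embed h O) := by
  simp only [dissipator, map_smul, map_sub, map_mul, embed_conjTranspose]

lemma embed_siteGen (h : Λ ⊆ Λ') {k : ℤ} (hk : k ∈ Λ) (O : Op Λ) :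
    embed h (siteGen L Γ Λ k O) = siteGen L Γ Λ' k (embed h O) := by
  simp only [siteGen, siteDissipator, map_add, map_smul, map_sum, embed_hamGen, embed_dissipator,
    embed_siteOp h hk, fieldTerm, map_neg]

lemma embed_bondTerm (h : Λ ⊆ Λ') {b : ℤ} (hb : b ∈ bonds Λ) :
    embed h (bondTerm Λ b) = bondTerm Λ' b := by
  rw [mem_bonds] at hb
  simp only [bondTerm, map_neg, map_mul, embed_siteOp h hb.1, embed_siteOp h hb.2]

lemma bonds_mono (h : Λ ⊆ Λ') : bonds Λ ⊆ bonds Λ' := fun _ hb =>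
  mem_bonds.2 ⟨h (mem_bonds.1 hb).1, h (mem_bonds.1 hb).2⟩

/-- On-site generators outside Λ vanish on embedded operators, so only the new bonds distinguish the
two dynamics. -/
lemma adjLiouvillian_embed (h : Λ ⊆ Λ') (O : Op Λ) :
    adjLiouvillian L Γ Λ' (embed h O) = embed h (adjLiouvillian L Γ Λ O)
      + ∑ b ∈ bonds Λ' \ bonds Λ, hamGen (bondTerm Λ' b) (embed h O) := by
  rw [adjLiouvillian_eq_sum, adjLiouvillian_eq_sum, map_add, map_sum, map_sum, add_assoc]
  congr 1
  · rw [← Finset.sum_subset h]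
    · exact Finset.sum_congr rfl fun k hk => (embed_siteGen h hk O).symm
    · intro k _ hk
      exact siteGen_eq_zero L Γ fun A => (commute_embed_siteOp h hk O A).symm
  · rw [← Finset.sum_sdiff (bonds_mono h), add_comm]
    congr 1
    exact Finset.sum_congr rfl fun b hb => by rw [embed_hamGen, embed_bondTerm h hb]

lemma norm_commutator_embed_siteOp_le (h : Λ ⊆ Λ') (k : ℤ) (O : Op Λ) (A : SpinOp) :
    ‖embed h O * siteOp Λ' k A - siteOp Λ' k A * embed h O‖ ≤ 2 * ‖A‖ * siteDist Λ k O := by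
  by_cases hk : k ∈ Λ
  · rw [← embed_siteOp h hk, ← map_mul, ← map_mul, ← map_sub, norm_embed]
    exact norm_commutator_siteOp_le O A
  · rw [(commute_embed_siteOp h hk O A).eq, sub_self, norm_zero]
    have : 0 ≤ siteDist Λ k O := apply_nonneg _ _
    positivity

lemma norm_hamGen_bondTerm_embed_le (h : Λ ⊆ Λ') (b : ℤ) (O : Op Λ) :
    ‖hamGen (bondTerm Λ' b) (embed h O)‖ ≤ 2 * siteDist Λ b O + 2 * siteDist Λ (b + 1) O := by
  refine (norm_hamGen_bondTerm_le_commutators b _).trans ?_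
  have h1 := norm_commutator_embed_siteOp_le h b O pauliZ
  have h2 := norm_commutator_embed_siteOp_le h (b + 1) O pauliZ
  rw [norm_pauliZ] at h1 h2
  linarith

lemma siteDist_of_notMem {k : ℤ} (hk : k ∉ Λ) (O : Op Λ) : siteDist Λ k O = 0 := by
  refine le_antisymm ?_ (apply_nonneg _ _)
  have hO : O ∈ siteCommutant Λ k := mem_siteCommutant.2 fun A => by
    rw [siteOp_of_notMem hk]; exact Commute.zero_left _
  simpa using siteDist_le hO O

/-- The influence of the sites added to a chain `{l, …, r}`, at its two ends. -/
def boundaryWeight (l r l' r' j : ℤ) : ℝ :=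
  (if r < r' then Real.exp (-|(r : ℝ) - j|) else 0)
    + (if l' < l then Real.exp (-|(l : ℝ) - j|) else 0)

/-- Among the new bonds only r and l - 1 touch the old chain, and each is present only if that end
has moved. -/
lemma sum_boundary_le {l r l' r' j : ℤ} (hl : l' ≤ l) (hr : r ≤ r') (hlr : l ≤ r) {M : ℝ}
    (hM : 0 ≤ M) {O : Op (Finset.Icc l r)}
    (hO : ∀ i ∈ Finset.Icc l r, siteDist _ i O ≤ M * Real.exp (-|(i : ℝ) - j|)) :
    ∑ b ∈ bonds (Finset.Icc l' r') \ bonds (Finset.Icc l r),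
      (2 * siteDist (Finset.Icc l r) b O + 2 * siteDist (Finset.Icc l r) (b + 1) O)
      ≤ 2 * M * boundaryWeight l r l' r' j := by
  have hrm := hO r (Finset.mem_Icc.2 ⟨hlr, le_rfl⟩)
  have hlm := hO l (Finset.mem_Icc.2 ⟨le_rfl, hlr⟩)
  calc _ ≤ ∑ b ∈ bonds (Finset.Icc l' r') \ bonds (Finset.Icc l r),
        ((if b = r then 2 * siteDist (Finset.Icc l r) r O else 0)
          + if b = l - 1 then 2 * siteDist (Finset.Icc l r) l O else 0) := by
        refine Finset.sum_le_sum fun b hb => ?_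
        simp only [Finset.mem_sdiff, mem_bonds, Finset.mem_Icc, not_and, not_le] at hb
        by_cases h1 : b = r
        · subst h1
          rw [siteDist_of_notMem (k := b + 1) (by simp), if_pos rfl, if_neg (by omega)]
          simp
        by_cases h2 : b = l - 1
        · rw [siteDist_of_notMem (k := b) (by simp; omega), if_neg h1, if_pos h2, h2,
            sub_add_cancel]
          simp
        · rw [siteDist_of_notMem (k := b) (by simp; omega),
            siteDist_of_notMem (k := b + 1) (by simp; omega), if_neg h1, if_neg h2]
          simp
    _ ≤ 2 * M * boundaryWeight l r l' r' j := by
        rw [Finset.sum_add_distrib, Finset.sum_ite_eq', Finset.sum_ite_eq', boundaryWeight, mul_add]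
        refine add_le_add ?_ ?_
        · split_ifs with h1 h2 h2
          · linarith
          · simp only [Finset.mem_sdiff, mem_bonds, Finset.mem_Icc] at h1
            omega
          · positivity
          · simp
        · split_ifs with h1 h2 h2
          · linarith
          · simp only [Finset.mem_sdiff, mem_bonds, Finset.mem_Icc] at h1
            omega
          · positivity
          · simp

/-- Duhamel's estimate in the larger chain: the difference starts at zero and is forced by the new
bonds acting on the evolution of the smaller chain. -/
lemma norm_heisenberg_sub_embed_le (hΓ : 0 ≤ Γ) {l r l' r' j : ℤ}
    (h : Finset.Icc l r ⊆ Finset.Icc l' r') (hl : l' ≤ l) (hr : r ≤ r')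
    (hj : j ∈ Finset.Icc l r) (B : SpinOp) {t : ℝ} (ht : 0 ≤ t) :
    ‖heisenberg L Γ _ t (siteOp (Finset.Icc l' r') j B)
        - embed h (heisenberg L Γ _ t (siteOp (Finset.Icc l r) j B))‖
      ≤ 2 * (‖B‖ * Real.exp (4 * (1 + Real.exp 1) * t)) * boundaryWeight l r l' r' j * t := by
  set Λ := Finset.Icc l r
  set Λ' := Finset.Icc l' r'
  set x : ℝ → Op Λ := fun s => heisenberg L Γ Λ s (siteOp Λ j B)
  let ιL : Op Λ →L[ℝ] Op Λ' :=
    (LinearMap.toContinuousLinearMap (embed h).toAlgHom.toLinearMap).restrictScalars ℝ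
  have hιL : ∀ O, ιL O = embed h O := fun O => rfl
  -- The exponential is frozen at the final time t, so the majorant is linear in s.
  set K := 2 * (‖B‖ * Real.exp (4 * (1 + Real.exp 1) * t)) * boundaryWeight l r l' r' j with hK
  have hd : ∀ s, HasDerivAt (fun s => heisenberg L Γ Λ' s (siteOp Λ' j B) - embed h (x s))
      (adjLiouvillian L Γ Λ' (heisenberg L Γ Λ' s (siteOp Λ' j B) - embed h (x s))
        + ∑ b ∈ bonds Λ' \ bonds Λ, hamGen (bondTerm Λ' b) (embed h (x s))) s := by
    intro s
    have h1 := hasDerivAt_heisenberg (L := L) (Γ := Γ) (siteOp Λ' j B) s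
    have h2 := ιL.hasFDerivAt.comp_hasDerivAt s
      (hasDerivAt_heisenberg (L := L) (Γ := Γ) (siteOp Λ j B) s)
    refine (h1.sub h2).congr_deriv ?_
    rw [map_sub, adjLiouvillian_embed, hιL]
    abel
  have hlr : l ≤ r := (Finset.mem_Icc.1 hj).1.trans (Finset.mem_Icc.1 hj).2
  have hfin := (diniLE_norm_adjLiouvillian (L := L) (Λ := Λ') hΓ).le_of_hasDerivAt
    normSeminorm_le_mul (T := t) (Φ := fun s => K * s) (Φ' := fun _ => K) ht hd ?_
    (fun s => by simpa using (hasDerivAt_id s).const_mul K) ?_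
  · exact hfin
  · simp only [x, heisenberg_zero, embed_siteOp h hj, sub_self, map_zero, mul_zero, le_refl]
  · intro s hs hst
    rw [zero_add, coe_normSeminorm]
    refine (norm_sum_le _ _).trans
      ((Finset.sum_le_sum fun b _ => norm_hamGen_bondTerm_embed_le h b (x s)).trans ?_)
    refine sum_boundary_le hl hr hlr (by positivity) fun i hi => ?_
    refine (siteDist_heisenberg_le hΓ hi j B hs).trans ?_
    rw [sub_eq_add_neg, Real.exp_add, ← mul_assoc]
    gcongr

lemma eventually_eq_or_far_of_tendsto {f : ℕ → ℤ} (hf : (Tendsto f atTop atTop ∨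
    Tendsto f atTop atBot) ∨ ∃ x, Tendsto f atTop (𝓝 x)) (j : ℤ) (R : ℝ) :
    ∀ᶠ N in atTop, (∀ n ≥ N, f n = f N) ∨ R ≤ |(f N : ℝ) - j| := by
  rcases hf with (h | h) | ⟨x, h⟩
  · have := (tendsto_intCast_atTop_iff (R := ℝ)).2 h
    filter_upwards [this.eventually_ge_atTop (R + j)] with N hN
    refine Or.inr (le_trans ?_ (le_abs_self _))
    linarith
  · have := (tendsto_intCast_atBot_iff (R := ℝ)).2 h
    filter_upwards [this.eventually_le_atBot (j - R)] with N hN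
    refine Or.inr (le_trans ?_ (neg_le_abs _))
    linarith
  · rw [nhds_discrete, tendsto_pure, eventually_atTop] at h
    obtain ⟨N, hN⟩ := h
    filter_upwards [eventually_ge_atTop N] with n hn
    exact Or.inl fun k hk => (hN k (hn.trans hk)).trans (hN n hn).symm

/-- Each end either becomes stationary, with weight zero, or moves to infinity, with weight tending
to zero. Finite, half-infinite and infinite limits are thus covered by one Cauchy argument. -/
lemma exists_tendsto_of_boundaryWeight {l r : ℕ → ℤ} (hl : Antitone l) (hr : Monotone r) (j : ℤ)
    {x : ℕ → ℝ} {C : ℝ} {N₀ : ℕ} (hx : ∀ N n, N₀ ≤ N → N ≤ n →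
      |x n - x N| ≤ C * boundaryWeight (l N) (r N) (l n) (r n) j) :
    ∃ y, Tendsto x atTop (𝓝 y) := by
  refine cauchySeq_tendsto_of_complete (Metric.cauchySeq_iff'.2 fun ε hε => ?_)
  have hC : 0 < |C| + 1 := by positivity
  obtain ⟨R, hR⟩ : ∃ R : ℝ, Real.exp (-R) < ε / (2 * (|C| + 1)) :=
    ((Real.tendsto_exp_neg_atTop_nhds_zero).eventually (gt_mem_nhds (by positivity))).exists
  have e1 := eventually_eq_or_far_of_tendsto (f := r) ((tendsto_atTop_of_monotone hr).imp_left Or.inl) j R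
  have e2 := eventually_eq_or_far_of_tendsto (f := l)
    ((tendsto_atTop_of_antitone hl).imp_left Or.inr) j R
  obtain ⟨N, hN1, hN2, hN0⟩ := (e1.and (e2.and (eventually_ge_atTop N₀))).exists
  refine ⟨N, fun n hn => ?_⟩
  have b1 : (if r N < r n then Real.exp (-|(r N : ℝ) - j|) else 0) ≤ Real.exp (-R) := by
    split_ifs with h
    · rcases hN1 with h1 | h1
      · exact absurd (h1 n hn) h.ne'
      · exact Real.exp_le_exp.2 (neg_le_neg h1)
    · positivity
  have b2 : (if l n < l N then Real.exp (-|(l N : ℝ) - j|) else 0) ≤ Real.exp (-R) := by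
    split_ifs with h
    · rcases hN2 with h1 | h1
      · exact absurd (h1 n hn) h.ne
      · exact Real.exp_le_exp.2 (neg_le_neg h1)
    · positivity
  have b0 : 0 ≤ boundaryWeight (l N) (r N) (l n) (r n) j := by
    unfold boundaryWeight
    positivity
  rw [Real.dist_eq]
  rw [lt_div_iff₀ (by positivity)] at hR
  calc _ ≤ C * boundaryWeight (l N) (r N) (l n) (r n) j := hx N n hN0 hn
    _ ≤ (|C| + 1) * (Real.exp (-R) + Real.exp (-R)) := by
        refine mul_le_mul ?_ (add_le_add b1 b2) b0 hC.le
        linarith [le_abs_self C]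
    _ < ε := by linarith

variable {l r : ℕ → ℤ}

lemma mem_chain_of_le (hl : Antitone l) (hr : Monotone r) {j : ℤ} {N n : ℕ} (hNn : N ≤ n)
    (hj : j ∈ Finset.Icc (l N) (r N)) : j ∈ Finset.Icc (l n) (r n) :=
  Finset.Icc_subset_Icc (hl hNn) (hr hNn) hj

lemma opCommutator_sub_left (O O' A : Op Λ) :
    opCommutator (O - O') A = opCommutator O A - opCommutator O' A := by
  simp only [opCommutator, sub_mul, mul_sub]
  abel

lemma norm_opCommutator_siteOp_le (O : Op Λ) (i : ℤ) (A : SpinOp) :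
    ‖opCommutator O (siteOp Λ i A)‖ ≤ 2 * ‖A‖ * ‖O‖ := by
  refine (NormKind.norm_opCommutator_le .operator O _).trans ?_
  rw [NormKind.norm_operator]
  have := norm_siteOp_le (Λ := Λ) (k := i) A
  gcongr

lemma opCommutator_zero_right (O : Op Λ) : opCommutator O 0 = 0 := by simp [opCommutator]

lemma opCommutator_zero_left (A : Op Λ) : opCommutator 0 A = 0 := by simp [opCommutator]

theorem exists_tendsto_evolNorm (κ : NormKind) (L : Fin m → SpinOp) (hΓ : 0 ≤ Γ)
    (hl : Antitone l) (hr : Monotone r) (j : ℤ) (B : SpinOp) {t : ℝ} (ht : 0 ≤ t) :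
    ∃ y, Tendsto (fun n => evolNorm κ L Γ (l n) (r n) j B t) atTop (𝓝 y) := by
  by_cases hj : ∃ N, j ∈ Finset.Icc (l N) (r N)
  · obtain ⟨N₀, hN₀⟩ := hj
    refine exists_tendsto_of_boundaryWeight hl hr j (N₀ := N₀)
      (C := 2 * (‖B‖ * Real.exp (4 * (1 + Real.exp 1) * t)) * t) fun N n h1 h2 => ?_
    have hs := Finset.Icc_subset_Icc (hl h2) (hr h2)
    have h := norm_heisenberg_sub_embed_le (L := L) hΓ hs (hl h2) (hr h2)
      (mem_chain_of_le hl hr h1 hN₀) B ht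
    rw [evolNorm, evolNorm, ← κ.norm_embed hs]
    refine (κ.abs_norm_sub_le _ _).trans (h.trans (le_of_eq (by ring)))
  · push Not at hj
    refine ⟨0, tendsto_const_nhds.congr fun n => ?_⟩
    rw [evolNorm, siteOp_of_notMem (hj n), heisenberg_apply_zero, κ.norm_zero]

theorem exists_tendsto_commNorm (κ : NormKind) (L : Fin m → SpinOp) (hΓ : 0 ≤ Γ)
    (hl : Antitone l) (hr : Monotone r) (j i : ℤ) (B A : SpinOp) {t : ℝ} (ht : 0 ≤ t) :
    ∃ y, Tendsto (fun n => commNorm κ L Γ (l n) (r n) j B i A t) atTop (𝓝 y) := by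
  by_cases hj : ∃ N, j ∈ Finset.Icc (l N) (r N)
  swap
  · push Not at hj
    refine ⟨0, tendsto_const_nhds.congr fun n => ?_⟩
    rw [commNorm, siteOp_of_notMem (hj n), heisenberg_apply_zero, opCommutator_zero_left,
      κ.norm_zero]
  by_cases hi : ∃ N, i ∈ Finset.Icc (l N) (r N)
  swap
  · push Not at hi
    refine ⟨0, tendsto_const_nhds.congr fun n => ?_⟩
    rw [commNorm, siteOp_of_notMem (hi n), opCommutator_zero_right, κ.norm_zero]
  obtain ⟨N₀, hN₀⟩ := hj
  obtain ⟨N₁, hN₁⟩ := hi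
  refine exists_tendsto_of_boundaryWeight hl hr j (N₀ := max N₀ N₁)
    (C := 2 * ‖A‖ * (2 * (‖B‖ * Real.exp (4 * (1 + Real.exp 1) * t)) * t)) fun N n h1 h2 => ?_
  have hs := Finset.Icc_subset_Icc (hl h2) (hr h2)
  have h := norm_heisenberg_sub_embed_le (L := L) hΓ hs (hl h2) (hr h2)
    (mem_chain_of_le hl hr ((le_max_left _ _).trans h1) hN₀) B ht
  have hi' := mem_chain_of_le hl hr ((le_max_right _ _).trans h1) hN₁
  rw [commNorm, commNorm, ← κ.norm_embed hs, opCommutator, opCommutator]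
  rw [map_sub, map_mul, map_mul, embed_siteOp hs hi', ← opCommutator, ← opCommutator]
  refine (κ.abs_norm_sub_le _ _).trans ?_
  rw [← opCommutator_sub_left]
  refine (norm_opCommutator_siteOp_le _ i A).trans ?_
  calc _ ≤ 2 * ‖A‖ * _ := mul_le_mul_of_nonneg_left h (by positivity)
    _ = _ := by ring

end ThermodynamicLimit

/-! ### Unitary evolution does not decrease the norms -/

section UnitaryDynamics

variable {m : ℕ} {L : Fin m → SpinOp} {Γ : ℝ} {Λ : Finset ℤ}

lemma adjLiouvillian_zero_apply (O : Op Λ) :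
    adjLiouvillian L 0 Λ O = hamGen (chaoticIsing Λ) O := by
  simp [adjLiouvillian_apply]

lemma hamGen_neg {n : Type*} [Fintype n] (h O : Matrix n n ℂ) : hamGen (-h) O = -hamGen h O := by
  simp only [hamGen, neg_mul, mul_neg]
  module

/-- Running time backwards replaces the Hamiltonian by its negative, which again generates a
contraction. -/
lemma norm_le_norm_heisenberg_unitary (O : Op Λ) {t : ℝ} (ht : 0 ≤ t) :
    ‖O‖ ≤ ‖heisenberg L 0 Λ t O‖ := by
  have hd : ∀ s, HasDerivAt (fun s => heisenberg L 0 Λ (t - s) O)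
      (hamGen (-chaoticIsing Λ) (heisenberg L 0 Λ (t - s) O) + 0) s := by
    intro s
    have h1 := (hasDerivAt_heisenberg (L := L) (Γ := 0) O (t - s)).scomp s
      ((hasDerivAt_id s).const_sub t)
    refine h1.congr_deriv ?_
    rw [hamGen_neg, adjLiouvillian_zero_apply, neg_one_smul, add_zero]
  have := (diniLE_norm_hamGen (h := -chaoticIsing Λ)
    (by rw [Matrix.conjTranspose_neg, chaoticIsing_conjTranspose])).le_of_hasDerivAt
    normSeminorm_le_mul (g := fun _ => 0) (Φ := fun _ => ‖heisenberg L 0 Λ t O‖)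
    (Φ' := fun _ => 0) ht hd (by simp) (fun s => hasDerivAt_const _ _) (by simp)
  simpa [heisenberg_zero] using this

/-- The derivative of tr(XXᴴ) is the trace of a commutator with the Hamiltonian. -/
lemma hsNorm_heisenberg_unitary (O : Op Λ) (t : ℝ) :
    hsNorm (heisenberg L 0 Λ t O) = hsNorm O := by
  let τ : Op Λ →L[ℝ] ℂ :=
    (LinearMap.toContinuousLinearMap (Matrix.traceLinearMap (Λ → Fin 2) ℂ ℂ)).restrictScalars ℝ
  have hd : ∀ s, HasDerivAt
      (fun s => τ (heisenberg L 0 Λ s O * star (heisenberg L 0 Λ s O))) 0 s := by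
    intro s
    have h1 := hasDerivAt_heisenberg (L := L) (Γ := 0) O s
    refine (τ.hasFDerivAt.comp_hasDerivAt s (h1.mul h1.star)).congr_deriv ?_
    set X := heisenberg L 0 Λ s O
    set H := chaoticIsing Λ with hH
    have hHH : Hᴴ = H := chaoticIsing_conjTranspose
    have e : adjLiouvillian L 0 Λ X * star X + X * star (adjLiouvillian L 0 Λ X)
        = Complex.I • (H * (X * Xᴴ) - (X * Xᴴ) * H) := by
      rw [adjLiouvillian_zero_apply, hamGen, ← hH]
      simp only [Matrix.star_eq_conjTranspose, Matrix.conjTranspose_smul, Matrix.conjTranspose_sub,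
        Matrix.conjTranspose_mul, hHH, RCLike.star_def, Complex.conj_I, smul_mul_assoc,
        mul_smul_comm, sub_mul, mul_sub, mul_assoc]
      module
    rw [e]
    change (Complex.I • (H * (X * Xᴴ) - (X * Xᴴ) * H)).trace = 0
    rw [Matrix.trace_smul, Matrix.trace_sub, Matrix.trace_mul_comm, sub_self, smul_zero]
  have h := is_const_of_deriv_eq_zero (fun s => (hd s).differentiableAt) (fun s => (hd s).deriv) t 0
  rw [heisenberg_zero] at h
  exact congrArg (fun z : ℂ => √z.re) h

lemma NormKind.le_norm_heisenberg_unitary (κ : NormKind) (O : Op Λ) {t : ℝ} (ht : 0 ≤ t) :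
    κ.norm O ≤ κ.norm (heisenberg L 0 Λ t O) := by
  cases κ
  · exact norm_le_norm_heisenberg_unitary O ht
  · rw [norm_frobenius, norm_frobenius, hsNorm_heisenberg_unitary]

end UnitaryDynamics

/-! ### Summing over the light cone and its tail -/

section LightConeSum

/-- Every distance occurs at most once on each side of j. -/
lemma sum_natAbs_sub_le (S : Finset ℤ) (j : ℤ) {φ : ℕ → ℝ} (hφ : ∀ n, 0 ≤ φ n) {M : ℕ}
    (hM : ∀ k ∈ S, (k - j).natAbs < M) :
    ∑ k ∈ S, φ (k - j).natAbs ≤ 2 * ∑ n ∈ Finset.range M, φ n := by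
  have key : ∀ S' ⊆ S, Set.InjOn (fun k : ℤ => (k - j).natAbs) S' →
      ∑ k ∈ S', φ (k - j).natAbs ≤ ∑ n ∈ Finset.range M, φ n := by
    intro S' hS' hinj
    rw [← Finset.sum_image (f := φ) hinj]
    refine Finset.sum_le_sum_of_subset_of_nonneg (fun n hn => ?_) fun n _ _ => hφ n
    obtain ⟨k, hk, rfl⟩ := Finset.mem_image.1 hn
    exact Finset.mem_range.2 (hM k (hS' hk))
  rw [← Finset.sum_filter_add_sum_filter_not S (fun k => j ≤ k), two_mul]
  refine add_le_add (key _ (Finset.filter_subset _ _) ?_) (key _ (Finset.filter_subset _ _) ?_)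
  · intro k hk k' hk' h
    simp only [Finset.coe_filter, Set.mem_ofPred_eq] at hk hk' h
    omega
  · intro k hk k' hk' h
    simp only [Finset.coe_filter, Set.mem_ofPred_eq] at hk hk' h
    omega

/-- The ⌊μ⌋ + 1 terms with n ≤ μ are bounded by 2 each; beyond them the exponential is dominated by
a geometric series. -/
lemma sum_range_min_exp_le {x c μ : ℝ} (hx : 0 < x) (hc : 0 ≤ c) (hμ : 0 ≤ μ) (M : ℕ) :
    ∑ n ∈ Finset.range (⌊μ⌋₊ + 1 + M), min 2 (c * Real.exp (-(x * (n - μ))))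
      ≤ 2 * (μ + 1) + c / (1 - Real.exp (-x)) := by
  have hρ : Real.exp (-x) < 1 := Real.exp_lt_one_iff.2 (neg_lt_zero.2 hx)
  have hρ0 : 0 ≤ Real.exp (-x) := (Real.exp_pos _).le
  rw [Finset.sum_range_add]
  refine add_le_add ?_ ?_
  · calc _ ≤ ∑ _n ∈ Finset.range (⌊μ⌋₊ + 1), (2 : ℝ) :=
          Finset.sum_le_sum fun n _ => min_le_left _ _
      _ = 2 * (⌊μ⌋₊ + 1) := by simp; ring
      _ ≤ _ := by
          have := Nat.floor_le hμ
          linarith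
  · calc _ ≤ ∑ n ∈ Finset.range M, c * Real.exp (-x) ^ n := by
          refine Finset.sum_le_sum fun n _ => (min_le_right _ _).trans ?_
          rw [← Real.exp_nat_mul]
          gcongr
          have := (Nat.lt_floor_add_one μ).le
          push_cast
          nlinarith
      _ = c * ∑ n ∈ Finset.range M, Real.exp (-x) ^ n := by rw [Finset.mul_sum]
      _ ≤ c * (1 - Real.exp (-x))⁻¹ := by
          gcongr
          rw [← tsum_geometric_of_lt_one hρ0 hρ]
          exact (summable_geometric_of_lt_one hρ0 hρ).sum_le_tsum _ fun n _ => by positivity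
      _ = _ := (div_eq_mul_inv _ _).symm

lemma sum_min_exp_le {x c μ : ℝ} (hx : 0 < x) (hc : 0 ≤ c) (hμ : 0 ≤ μ) (S : Finset ℤ) (j : ℤ) :
    ∑ k ∈ S, min 2 (c * Real.exp (-(x * (|(k : ℝ) - j| - μ))))
      ≤ 4 * (μ + 1) + 2 * (c / (1 - Real.exp (-x))) := by
  have h := sum_natAbs_sub_le S j (φ := fun n => min 2 (c * Real.exp (-(x * (n - μ)))))
    (fun n => by positivity) (M := ⌊μ⌋₊ + 1 + (S.sup fun k => (k - j).natAbs)) fun k hk => by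
      have := Finset.le_sup (f := fun k : ℤ => (k - j).natAbs) hk
      omega
  have h2 := sum_range_min_exp_le hx hc hμ (S.sup fun k => (k - j).natAbs)
  refine le_trans (le_of_eq (Finset.sum_congr rfl fun k _ => ?_)) (h.trans ?_)
  · simp only [Nat.cast_natAbs, Int.cast_abs, Int.cast_sub]
  · linarith

end LightConeSum

/-! ### Dissipative against unitary evolution -/

section Comparison

variable {m : ℕ} {L : Fin m → SpinOp} {Γ K a v ξ c : ℝ} {Λ : Finset ℤ}

lemma norm_siteDissipator_le (hK : ∑ α, ‖L α‖ ^ 2 ≤ K) {k : ℤ} {O : Op Λ} {β : ℝ} (hβ : 0 ≤ β)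
    (h : ∀ A, ‖O * siteOp Λ k A - siteOp Λ k A * O‖ ≤ ‖A‖ * β) :
    ‖siteDissipator L Λ k O‖ ≤ 2 * K * β := by
  calc _ ≤ ∑ α, ‖dissipator (siteOp Λ k (L α)) O‖ := norm_sum_le _ _
    _ ≤ ∑ α, ‖L α‖ ^ 2 * (2 * β) := by
        refine Finset.sum_le_sum fun α _ => ?_
        rw [dissipator_eq, siteOp_conjTranspose]
        have h1 := h (L α)
        have h2 := h (L α)ᴴ
        have h3 : ‖(L α)ᴴ‖ = ‖L α‖ := Matrix.l2_opNorm_conjTranspose _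
        rw [norm_sub_rev] at h2
        rw [h3] at h2
        have h4 := norm_siteOp_le (Λ := Λ) (k := k) (L α)
        have h5 := norm_siteOp_le (Λ := Λ) (k := k) (L α)ᴴ
        rw [h3] at h5
        calc _ ≤ ‖L α‖ * (‖L α‖ * β) + ‖L α‖ * β * ‖L α‖ := by
              refine (norm_add_le _ _).trans (add_le_add ((norm_mul_le _ _).trans ?_)
                ((norm_mul_le _ _).trans ?_))
              · gcongr
              · gcongr
          _ = _ := by ring
    _ = (∑ α, ‖L α‖ ^ 2) * (2 * β) := (Finset.sum_mul _ _ _).symm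
    _ ≤ K * (2 * β) := by gcongr
    _ = _ := by ring

/-- The coefficient of the linear term in the bound for the effect of the dissipation. -/
def spreadConst (c x : ℝ) : ℝ := 4 + 2 * (c / (1 - Real.exp (-x)))

lemma spreadConst_nonneg {x : ℝ} (hc : 0 ≤ c) (hx : 0 < x) : 0 ≤ spreadConst c x := by
  have : Real.exp (-x) < 1 := Real.exp_lt_one_iff.2 (neg_lt_zero.2 hx)
  have : 0 < 1 - Real.exp (-x) := by linarith
  unfold spreadConst
  positivity

/-- The dissipators act as a forcing on the unitary solution, so only the Lieb-Robinson constants of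
the unitary chain enter. The forcing grows like the number of sites in the cone, hence the square of
t. -/
lemma norm_heisenberg_sub_unitary_le (hK : ∑ α, ‖L α‖ ^ 2 ≤ K) (ha : 0 < a) (hv : 0 < v)
    (hξ : 0 < ξ) (hc : 0 < c) (hLR : LiebRobinson L 0 a v ξ c) (hΓ : 0 ≤ Γ) {l r j : ℤ}
    (hj : j ∈ Finset.Icc l r) (B : SpinOp) {t : ℝ} (ht : 0 ≤ t) :
    ‖heisenberg L Γ _ t (siteOp (Finset.Icc l r) j B)
        - heisenberg L 0 _ t (siteOp (Finset.Icc l r) j B)‖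
      ≤ Γ * K * ‖B‖ * (2 * (v / a) * t ^ 2 + spreadConst c (a / ξ) * t) := by
  have hK0 : 0 ≤ K := le_trans (by positivity) hK
  set Λ := Finset.Icc l r
  set x : ℝ → Op Λ := fun s => heisenberg L 0 Λ s (siteOp Λ j B) with hx
  have hd : ∀ s, HasDerivAt (fun s => heisenberg L Γ Λ s (siteOp Λ j B) - x s)
      (adjLiouvillian L Γ Λ (heisenberg L Γ Λ s (siteOp Λ j B) - x s)
        + ((Γ / 2 : ℝ) : ℂ) • ∑ k ∈ Λ, siteDissipator L Λ k (x s)) s := by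
    intro s
    refine ((hasDerivAt_heisenberg (L := L) (Γ := Γ) (siteOp Λ j B) s).sub
      (hasDerivAt_heisenberg (L := L) (Γ := 0) (siteOp Λ j B) s)).congr_deriv ?_
    rw [map_sub, adjLiouvillian_zero_apply, adjLiouvillian_apply (x s)]
    abel
  have hfin := (diniLE_norm_adjLiouvillian (L := L) (Λ := Λ) hΓ).le_of_hasDerivAt
    normSeminorm_le_mul (T := t) (Φ := fun s => Γ * K * ‖B‖ * (2 * (v / a) * s ^ 2 +
      spreadConst c (a / ξ) * s)) (Φ' := fun s => Γ * K * ‖B‖ * (2 * (v / a) * (2 * s) +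
      spreadConst c (a / ξ))) ht hd ?_ ?_ ?_
  · exact hfin
  · simp [hx, heisenberg_zero]
  · intro s
    have h1 := ((hasDerivAt_pow 2 s).const_mul (2 * (v / a))).add
      ((hasDerivAt_id s).const_mul (spreadConst c (a / ξ)))
    simpa using h1.const_mul (Γ * K * ‖B‖)
  · intro s hs _
    -- The trivial commutator bound 2 is used inside the cone of radius vs/a sites, the
    -- Lieb-Robinson bound outside.
    set β : ℤ → ℝ := fun k =>
      min 2 (c * Real.exp (-(a / ξ * (|(k : ℝ) - j| - v * s / a)))) with hβ
    have hβ0 : ∀ k, 0 ≤ β k := fun k => by positivity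
    have hcomm : ∀ k ∈ Λ, ∀ A, ‖x s * siteOp Λ k A - siteOp Λ k A * x s‖ ≤ ‖A‖ * (‖B‖ * β k) := by
      intro k hk A
      rw [hβ]
      simp only
      rw [mul_min_of_nonneg _ _ (norm_nonneg B), mul_min_of_nonneg _ _ (norm_nonneg A)]
      refine le_min ?_ ?_
      · refine (norm_opCommutator_siteOp_le (x s) k A).trans ?_
        have := (norm_heisenberg_le (L := L) le_rfl hs (siteOp Λ j B)).trans (norm_siteOp_le B)
        calc _ ≤ 2 * ‖A‖ * ‖B‖ := by gcongr
          _ = _ := by ring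
      · refine (hLR l r k j hk hj A B s hs).trans (le_of_eq ?_)
        have e : -(a * |(k : ℝ) - j| - v * s) / ξ = -(a / ξ * (|(k : ℝ) - j| - v * s / a)) := by
          field_simp
        rw [e]
        ring
    rw [zero_add, coe_normSeminorm, norm_smul, Complex.norm_real, Real.norm_of_nonneg (by positivity)]
    calc Γ / 2 * ‖∑ k ∈ Λ, siteDissipator L Λ k (x s)‖
        ≤ Γ / 2 * ∑ k ∈ Λ, 2 * K * (‖B‖ * β k) := by
          gcongr
          exact norm_sum_le_of_le _ fun k hk => norm_siteDissipator_le hK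
            (mul_nonneg (norm_nonneg B) (hβ0 k)) (hcomm k hk)
      _ = Γ * K * ‖B‖ * ∑ k ∈ Λ, β k := by
          rw [← Finset.mul_sum, ← Finset.mul_sum]
          ring
      _ ≤ Γ * K * ‖B‖ * (4 * (v * s / a + 1) + 2 * (c / (1 - Real.exp (-(a / ξ))))) := by
          gcongr
          exact sum_min_exp_le (by positivity) hc.le (by positivity) Λ j
      _ = _ := by
          rw [spreadConst]
          ring

/-- The constant in the bound for the effect of the dissipation up to the time
`lam * √(ε a / (v Γ))`. -/
def compareConst (K lam c x : ℝ) : ℝ := K * (2 * lam ^ 2 + spreadConst c x * x * lam)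

lemma norm_heisenberg_sub_unitary_le_compareConst (hK : ∑ α, ‖L α‖ ^ 2 ≤ K) (ha : 0 < a)
    (hv : 0 < v) (hξ : 0 < ξ) (hc : 0 < c) (hLR : LiebRobinson L 0 a v ξ c) {ε : ℝ} (hε : 0 < ε)
    (hΓ : 0 < Γ) (hΓε : Γ ≤ ε * a * v / ξ ^ 2) {lam : ℝ} (hlam : 0 ≤ lam) {l r j : ℤ}
    (hj : j ∈ Finset.Icc l r) (B : SpinOp) {t : ℝ} (ht : 0 ≤ t)
    (ht' : t ≤ lam * √(ε * a / (v * Γ))) :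
    ‖heisenberg L Γ _ t (siteOp (Finset.Icc l r) j B)
        - heisenberg L 0 _ t (siteOp (Finset.Icc l r) j B)‖
      ≤ compareConst K lam c (a / ξ) * ε * ‖B‖ := by
  have hK0 : 0 ≤ K := le_trans (by positivity) hK
  refine (norm_heisenberg_sub_unitary_le hK ha hv hξ hc hLR hΓ.le hj B ht).trans ?_
  set D := spreadConst c (a / ξ)
  have hD : 0 ≤ D := spreadConst_nonneg hc.le (by positivity)
  set T := √(ε * a / (v * Γ)) with hT
  have hT2 : T ^ 2 = ε * a / (v * Γ) := Real.sq_sqrt (by positivity)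
  have hT0 : 0 ≤ T := Real.sqrt_nonneg _
  have h1 : Γ * (v / a) * t ^ 2 ≤ lam ^ 2 * ε := by
    calc _ ≤ Γ * (v / a) * (lam * T) ^ 2 := by gcongr
      _ = lam ^ 2 * ε := by
        rw [mul_pow, hT2]
        field_simp
  -- The bound on Γ enters here: it makes the term linear in t of order ε as well.
  have h2 : Γ * T ≤ ε * (a / ξ) := by
    refine le_of_sq_le_sq ?_ (by positivity)
    rw [mul_pow, hT2]
    calc Γ ^ 2 * (ε * a / (v * Γ)) = Γ * (ε * a / v) := by field_simp
      _ ≤ ε * a * v / ξ ^ 2 * (ε * a / v) := by gcongr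
      _ = _ := by field_simp
  have h3 : Γ * t ≤ lam * (ε * (a / ξ)) := by
    calc _ ≤ Γ * (lam * T) := by gcongr
      _ = lam * (Γ * T) := by ring
      _ ≤ _ := by gcongr
  calc Γ * K * ‖B‖ * (2 * (v / a) * t ^ 2 + D * t)
      = K * ‖B‖ * (2 * (Γ * (v / a) * t ^ 2) + D * (Γ * t)) := by ring
    _ ≤ K * ‖B‖ * (2 * (lam ^ 2 * ε) + D * (lam * (ε * (a / ξ)))) := by gcongr
    _ = _ := by rw [compareConst]; ring

end Comparison

/-! ### Stability of the revealed width -/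

section LightConeWidth

/-- A site at which q misses the front is either at distance at least W, or both of its times are at
most (W + W/2)/u, where q and q' are close. In the second case q' misses the front too, with the
threshold raised by two errors η/2. -/
lemma min_lightConeWidth_le {S : Set ℤ} {j : ℤ} {a u w δ η W : ℝ} {q q' : ℤ → ℝ → ℝ}
    (hu : 0 < u) (hwW : w ≤ W)
    (h : ∀ i ∈ S, ∀ t, 0 ≤ t → t ≤ 3 / 2 * W / u → |q i t - q' i t| ≤ η / 2) (hw : 0 ≤ w) :
    min (lightConeWidth S j a u w (δ + η) q') ((W : ℝ) : EReal) ≤ lightConeWidth S j a u w δ q := by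
  refine le_sInf ?_
  rintro _ ⟨i, hi, rfl, hd, hlt⟩
  rcases le_or_gt W (a * |(i : ℝ) - j|) with hW | hW
  · exact (min_le_right _ _).trans (EReal.coe_le_coe_iff.2 hW)
  · refine (min_le_left _ _).trans (sInf_le ⟨i, hi, rfl, hd, ?_⟩)
    set d := a * |(i : ℝ) - j|
    have h1 := abs_le.1 (h i hi ((d + w / 2) / u) (div_nonneg (by linarith) hu.le)
      (by gcongr; linarith))
    have h2 := abs_le.1 (h i hi ((d - w / 2) / u) (div_nonneg (by linarith) hu.le)
      (by gcongr; linarith))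
    rw [abs_lt] at hlt ⊢
    constructor <;> linarith [h1.1, h1.2, h2.1, h2.2, hlt.1, hlt.2]

end LightConeWidth

/-! ### Estimates for the limiting signals -/

section Signals

variable {m : ℕ} {L : Fin m → SpinOp} {Γ K a v ξ c : ℝ} {l r : ℕ → ℤ}

lemma tendsto_commSignal (κ : NormKind) (L : Fin m → SpinOp) (hΓ : 0 ≤ Γ)
    (hl : Antitone l) (hr : Monotone r) (j i : ℤ) (B A : SpinOp) {t : ℝ} (ht : 0 ≤ t) :
    Tendsto (fun n => commNorm κ L Γ (l n) (r n) j B i A t) atTop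
      (𝓝 (commSignal κ L Γ l r j B i A t)) :=
  tendsto_nhds_limUnder (exists_tendsto_commNorm κ L hΓ hl hr j i B A ht)

lemma tendsto_evolSignal (κ : NormKind) (L : Fin m → SpinOp) (hΓ : 0 ≤ Γ)
    (hl : Antitone l) (hr : Monotone r) (j : ℤ) (B : SpinOp) {t : ℝ} (ht : 0 ≤ t) :
    Tendsto (fun n => evolNorm κ L Γ (l n) (r n) j B t) atTop
      (𝓝 (evolSignal κ L Γ l r j B t)) :=
  tendsto_nhds_limUnder (exists_tendsto_evolNorm κ L hΓ hl hr j B ht)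

lemma evolSignal_nonneg (κ : NormKind) (L : Fin m → SpinOp) (hΓ : 0 ≤ Γ)
    (hl : Antitone l) (hr : Monotone r) (j : ℤ) (B : SpinOp) {t : ℝ} (ht : 0 ≤ t) :
    0 ≤ evolSignal κ L Γ l r j B t :=
  ge_of_tendsto' (tendsto_evolSignal κ L hΓ hl hr j B ht) fun _ => κ.norm_nonneg _

lemma commSignal_nonneg (κ : NormKind) (L : Fin m → SpinOp) (hΓ : 0 ≤ Γ)
    (hl : Antitone l) (hr : Monotone r) (j i : ℤ) (B A : SpinOp) {t : ℝ} (ht : 0 ≤ t) :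
    0 ≤ commSignal κ L Γ l r j B i A t :=
  ge_of_tendsto' (tendsto_commSignal κ L hΓ hl hr j i B A ht) fun _ => κ.norm_nonneg _

lemma commSignal_le (κ : NormKind) (L : Fin m → SpinOp) (hΓ : 0 ≤ Γ)
    (hl : Antitone l) (hr : Monotone r) (j i : ℤ) (B A : SpinOp) {t : ℝ} (ht : 0 ≤ t) :
    commSignal κ L Γ l r j B i A t ≤ 2 * ‖A‖ * evolSignal κ L Γ l r j B t :=
  le_of_tendsto_of_tendsto' (tendsto_commSignal κ L hΓ hl hr j i B A ht)
    ((tendsto_evolSignal κ L hΓ hl hr j B ht).const_mul _) fun n => by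
      refine (κ.norm_opCommutator_le _ _).trans ?_
      have := norm_siteOp_le (Λ := Finset.Icc (l n) (r n)) (k := i) A
      have h2 := κ.norm_nonneg (heisenberg L Γ (Finset.Icc (l n) (r n)) t (siteOp _ j B))
      rw [evolNorm]
      gcongr

lemma evolSignal_unitary_ge (κ : NormKind) (L : Fin m → SpinOp) (hl : Antitone l)
    (hr : Monotone r) {j : ℤ} (hj : ∃ n, j ∈ Finset.Icc (l n) (r n)) (B : SpinOp) {t : ℝ}
    (ht : 0 ≤ t) : ‖B‖ / √2 ≤ evolSignal κ L 0 l r j B t := by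
  obtain ⟨N, hN⟩ := hj
  refine ge_of_tendsto (tendsto_evolSignal κ L le_rfl hl hr j B ht) ?_
  filter_upwards [eventually_ge_atTop N] with n hn
  exact (κ.norm_siteOp_ge (mem_chain_of_le hl hr hn hN) B).trans
    (κ.le_norm_heisenberg_unitary _ ht)

/-- Since Q/E is bounded a priori by 2M, only the unitary denominator E₀ needs a lower bound. For E
= 0 also Q = 0, and the convention Q/0 = 0 is harmless. -/
lemma abs_div_sub_div_le {E E₀ Q Q₀ M η b : ℝ} (hE : 0 ≤ E) (hb : 0 < b) (hE₀ : b ≤ E₀)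
    (hQ : 0 ≤ Q) (hQE : Q ≤ 2 * M * E) (hM : 0 ≤ M) (h1 : |E - E₀| ≤ η)
    (h2 : |Q - Q₀| ≤ 2 * M * η) : |Q / E - Q₀ / E₀| ≤ 4 * M * η / b := by
  have hE₀' : 0 < E₀ := hb.trans_le hE₀
  have hη : 0 ≤ η := (abs_nonneg _).trans h1
  have hdiv : Q / E ≤ 2 * M := div_le_of_le_mul₀ hE (by positivity) hQE
  have hQE' : Q / E * E = Q := by
    rcases hE.eq_or_lt with h | h
    · subst h
      simp only [mul_zero] at hQE ⊢
      exact le_antisymm hQ hQE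
    · field_simp
  have e : Q / E - Q₀ / E₀ = ((Q - Q₀) - Q / E * (E - E₀)) / E₀ := by
    rw [mul_sub, hQE']
    field_simp
    ring
  rw [e, abs_div, abs_of_pos hE₀']
  refine div_le_div₀ (by positivity) ?_ hb hE₀
  calc |Q - Q₀ - Q / E * (E - E₀)| ≤ |Q - Q₀| + |Q / E * (E - E₀)| := abs_sub _ _
    _ ≤ 2 * M * η + 2 * M * η := by
        rw [abs_mul, abs_of_nonneg (div_nonneg hQ hE)]
        gcongr
    _ = _ := by ring

/-- The factor 6 covers all signals: 1 for the evolved norm, 2 for the commutator, and 4√2 ≤ 6 for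
the ratio, whose denominator is at least ‖B‖/√2. -/
lemma signal_comparison (hK : ∑ α, ‖L α‖ ^ 2 ≤ K) (ha : 0 < a)
    (hv : 0 < v) (hξ : 0 < ξ) (hc : 0 < c) (hLR : LiebRobinson L 0 a v ξ c) {ε : ℝ} (hε : 0 < ε)
    (hΓ : 0 < Γ) (hΓε : Γ ≤ ε * a * v / ξ ^ 2) (κ : NormKind) (hl : Antitone l) (hr : Monotone r)
    {j : ℤ} (B A : SpinOp) (hj : ∃ n, j ∈ Finset.Icc (l n) (r n)) {lam : ℝ} (hlam : 0 ≤ lam)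
    (i : ℤ) {t : ℝ} (ht : 0 ≤ t) (ht' : t ≤ lam * √(ε * a / (v * Γ))) :
    |evolSignal κ L Γ l r j B t - evolSignal κ L 0 l r j B t|
        ≤ 6 * compareConst K lam c (a / ξ) * ε * ‖B‖ ∧
    (B ≠ 0 → 6 * compareConst K lam c (a / ξ) * ε ≤ 1 / 2 → 0 < evolSignal κ L Γ l r j B t) ∧
    |commSignal κ L Γ l r j B i A t - commSignal κ L 0 l r j B i A t|
      ≤ 6 * compareConst K lam c (a / ξ) * ε * (‖A‖ * ‖B‖) ∧
    |ratioSignal κ L Γ l r j B i A t - ratioSignal κ L 0 l r j B i A t|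
      ≤ 6 * compareConst K lam c (a / ξ) * ε * ‖A‖ := by
  have hK0 : 0 ≤ K := le_trans (by positivity) hK
  have hC : 0 ≤ compareConst K lam c (a / ξ) := by
    have := spreadConst_nonneg hc.le (div_pos ha hξ)
    unfold compareConst
    positivity
  have hE₀ := evolSignal_unitary_ge κ L hl hr hj B ht
  obtain ⟨N, hN⟩ := hj
  set C := compareConst K lam c (a / ξ) with hCdef
  have hfin : ∀ n ≥ N, ‖heisenberg L Γ _ t (siteOp (Finset.Icc (l n) (r n)) j B)
      - heisenberg L 0 _ t (siteOp (Finset.Icc (l n) (r n)) j B)‖ ≤ C * ε * ‖B‖ := fun n hn =>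
    norm_heisenberg_sub_unitary_le_compareConst hK ha hv hξ hc hLR hε hΓ hΓε hlam
      (mem_chain_of_le hl hr hn hN) B ht ht'
  have hE : |evolSignal κ L Γ l r j B t - evolSignal κ L 0 l r j B t| ≤ C * ε * ‖B‖ := by
    refine le_of_tendsto (((tendsto_evolSignal κ L hΓ.le hl hr j B ht).sub
      (tendsto_evolSignal κ L le_rfl hl hr j B ht)).abs) ?_
    filter_upwards [eventually_ge_atTop N] with n hn
    exact (κ.abs_norm_sub_le _ _).trans (hfin n hn)
  have hQ : |commSignal κ L Γ l r j B i A t - commSignal κ L 0 l r j B i A t|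
      ≤ 2 * ‖A‖ * (C * ε * ‖B‖) := by
    refine le_of_tendsto (((tendsto_commSignal κ L hΓ.le hl hr j i B A ht).sub
      (tendsto_commSignal κ L le_rfl hl hr j i B A ht)).abs) ?_
    filter_upwards [eventually_ge_atTop N] with n hn
    refine (κ.abs_norm_sub_le _ _).trans ?_
    rw [← opCommutator_sub_left]
    refine (norm_opCommutator_siteOp_le _ i A).trans ?_
    gcongr
    exact hfin n hn
  have hE_nonneg := evolSignal_nonneg κ L hΓ.le hl hr j B ht
  have hQ_nonneg := commSignal_nonneg κ L hΓ.le hl hr j i B A ht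
  have hQE := commSignal_le κ L hΓ.le hl hr j i B A ht
  have hs2 : √2 ≤ 3 / 2 := by
    rw [Real.sqrt_le_left (by norm_num)]
    norm_num
  have hs0 : 0 < √2 := by positivity
  have hCB : 0 ≤ C * ε * ‖B‖ := by positivity
  refine ⟨by linarith, fun hB hCε => ?_, ?_, ?_⟩
  · have hB' : 0 < ‖B‖ := norm_pos_iff.2 hB
    have h1 := (abs_le.1 hE).1
    have h2 : ‖B‖ * (2 / 3) ≤ ‖B‖ / √2 := by
      rw [le_div_iff₀ hs0]
      nlinarith
    nlinarith
  · refine hQ.trans ?_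
    have : 0 ≤ C * ε * (‖A‖ * ‖B‖) := by positivity
    linarith
  · rcases eq_or_ne B 0 with rfl | hB
    · have h0 : ∀ Γ', 0 ≤ Γ' → ratioSignal κ L Γ' l r j 0 i A t = 0 := by
        intro Γ' _
        have : commSignal κ L Γ' l r j 0 i A t = 0 := by
          refine (tendsto_const_nhds.congr fun n => ?_).limUnder_eq
          rw [commNorm, siteOp_zero, heisenberg_apply_zero, opCommutator_zero_left, κ.norm_zero]
        rw [ratioSignal, this, zero_div]
      rw [h0 Γ hΓ.le, h0 0 le_rfl, sub_self, abs_zero]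
      positivity
    · have hB' : 0 < ‖B‖ := norm_pos_iff.2 hB
      refine (abs_div_sub_div_le hE_nonneg (div_pos hB' hs0) hE₀ hQ_nonneg hQE
        (norm_nonneg A) hE hQ).trans ?_
      calc 4 * ‖A‖ * (C * ε * ‖B‖) / (‖B‖ / √2) = 4 * √2 * (C * ε * ‖A‖) := by field_simp
        _ ≤ 6 * (C * ε * ‖A‖) := by
          have : 0 ≤ C * ε * ‖A‖ := by positivity
          gcongr
          linarith
        _ = _ := by ring

end Signals

end

theorem proposition1 :
    -- Lieb-Robinson constants exist, uniformly in the on-site dissipation and its rate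
    (∀ a : ℝ, 0 < a → ∃ v ξ c : ℝ, 0 < v ∧ 0 < ξ ∧ 0 < c ∧
      ∀ (m : ℕ) (L : Fin m → SpinOp) (Γ : ℝ), 0 ≤ Γ → LiebRobinson L Γ a v ξ c) ∧
    -- the norms converge along every increasing sequence of chains
    (∀ (κ : NormKind) (m : ℕ) (L : Fin m → SpinOp) (Γ : ℝ) (l r : ℕ → ℤ) (j i : ℤ)
      (B A : SpinOp) (t : ℝ), 0 ≤ Γ → Antitone l → Monotone r → 0 ≤ t →
      (∃ x : ℝ, Tendsto (fun n => commNorm κ L Γ (l n) (r n) j B i A t) atTop (𝓝 x)) ∧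
      (∃ y : ℝ, Tendsto (fun n => evolNorm κ L Γ (l n) (r n) j B t) atTop (𝓝 y))) ∧
    -- comparison with the unitary chain
    ∀ K : ℝ, ∃ (C : ℝ → ℝ → ℝ) (C' : ℝ → ℝ → ℝ → ℝ),
      ∀ (m : ℕ) (L : Fin m → SpinOp), ∑ α, ‖L α‖ ^ 2 ≤ K →
      ∀ a v ξ c : ℝ, 0 < a → 0 < v → 0 < ξ → 0 < c → LiebRobinson L 0 a v ξ c →
      ∀ ε Γ : ℝ, 0 < ε → 0 < Γ → Γ ≤ ε * a * v / ξ ^ 2 →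
      ∀ (κ : NormKind) (l r : ℕ → ℤ), Antitone l → Monotone r →
      ∀ (j : ℤ) (B A : SpinOp), (∃ n, j ∈ Finset.Icc (l n) (r n)) →
        -- agreement up to order `ε` in the whole time range
        (∀ i : ℤ, (∃ n, i ∈ Finset.Icc (l n) (r n)) →
          ∀ t : ℝ, 0 ≤ t → t ≤ √(ε * a / (v * Γ)) →
          |evolSignal κ L Γ l r j B t - evolSignal κ L 0 l r j B t| ≤ C c (a / ξ) * ε * ‖B‖ ∧
          (B ≠ 0 → C c (a / ξ) * ε ≤ 1 / 2 → 0 < evolSignal κ L Γ l r j B t) ∧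
          |commSignal κ L Γ l r j B i A t - commSignal κ L 0 l r j B i A t|
            ≤ C c (a / ξ) * ε * (‖A‖ * ‖B‖) ∧
          |ratioSignal κ L Γ l r j B i A t - ratioSignal κ L 0 l r j B i A t|
            ≤ C c (a / ξ) * ε * ‖A‖) ∧
        -- the width of the revealed light cone
        (∀ u w δ : ℝ, 0 < u → 0 ≤ w → w ≤ √(ε * a * v / Γ) →
          min (lightConeWidth {i | ∃ n, i ∈ Finset.Icc (l n) (r n)} j a u w
                (δ + C' c (a / ξ) (v / u) * ε * (‖A‖ * ‖B‖))
                (fun i t => commSignal κ L 0 l r j B i A t))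
              ((√(ε * a * v / Γ) : ℝ) : EReal)
            ≤ lightConeWidth {i | ∃ n, i ∈ Finset.Icc (l n) (r n)} j a u w δ
                (fun i t => commSignal κ L Γ l r j B i A t) ∧
          min (lightConeWidth {i | ∃ n, i ∈ Finset.Icc (l n) (r n)} j a u w
                (δ + C' c (a / ξ) (v / u) * ε * ‖A‖)
                (fun i t => ratioSignal κ L 0 l r j B i A t))
              ((√(ε * a * v / Γ) : ℝ) : EReal)
            ≤ lightConeWidth {i | ∃ n, i ∈ Finset.Icc (l n) (r n)} j a u w δ
                (fun i t => ratioSignal κ L Γ l r j B i A t)) := by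
  refine ⟨fun a ha => ⟨4 * (1 + Real.exp 1) * a, a, 2, by positivity, ha, by norm_num,
    fun m L Γ hΓ => liebRobinson_of_nonneg L hΓ ha⟩,
    fun κ m L Γ l r j i B A t hΓ hl hr ht => ⟨exists_tendsto_commNorm κ L hΓ hl hr j i B A ht,
      exists_tendsto_evolNorm κ L hΓ hl hr j B ht⟩, fun K => ?_⟩
  -- The time scale is `lam = 1` for the agreement. For the width, times up to (3/2)W/u occur, hence
  -- `lam = 3/2 * (v / u)`; the factor 2 pays for comparing at two times.
  refine ⟨fun c x => 6 * compareConst K 1 c x,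
    fun c x z => 2 * (6 * compareConst K (3 / 2 * z) c x), ?_⟩
  intro m L hK a v ξ c ha hv hξ hc hLR ε Γ hε hΓ hΓε κ l r hl hr j B A hj
  refine ⟨fun i _ t ht ht' => signal_comparison hK ha hv hξ hc hLR hε hΓ hΓε κ hl hr B A hj
    zero_le_one i ht (by rwa [one_mul]), fun u w δ hu hw hwW => ?_⟩
  -- The maximal width is the distance covered at speed v during the comparison time.
  have hW : √(ε * a * v / Γ) = v * √(ε * a / (v * Γ)) := by
    rw [Real.sqrt_eq_iff_mul_self_eq (by positivity) (by positivity), mul_mul_mul_comm,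
      Real.mul_self_sqrt (by positivity)]
    field_simp
  have key := fun (i : ℤ) (t : ℝ) (ht : 0 ≤ t) (ht' : t ≤ 3 / 2 * √(ε * a * v / Γ) / u) =>
    signal_comparison hK ha hv hξ hc hLR hε hΓ hΓε κ hl hr B A hj
      (lam := 3 / 2 * (v / u)) (by positivity) i ht
      (ht'.trans (le_of_eq (by rw [hW]; ring)))
  constructor
  · refine min_lightConeWidth_le hu hwW (fun i _ t ht ht' => ?_) hw
    refine (key i t ht ht').2.2.1.trans (le_of_eq (by ring))
  · refine min_lightConeWidth_le hu hwW (fun i _ t ht ht' => ?_) hw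
    refine (key i t ht ht').2.2.2.trans (le_of_eq (by ring))
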